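/- Let $(X,\mathcal{O}_X)$ be a locally ringed space, $A=\Gamma(X,\mathcal{O}_X)$, $Y=\operatorname{Spec} A$, and $\varphi:X\to Y$ the canonical morphism. An $\mathcal{O}_X$-module $F$ is called $A$-coherent if there is an exact sequence $\mathcal{O}_X^m\to\mathcal{O}_X^n\to F\to 0$ of $\mathcal{O}_X$-modules with integers $m,n\ge 1$. An $\mathcal{O}_X$-module $F$ is coherent if it is of finite type and, for every open $U\subseteq X$, every integer $n\geq 0$ and every morphism $\mathcal{O}_U^n\to F|_U$, the kernel of this morphism is of finite type (and similarly on $Y$); it is finitely presented if it is, locally, the cokernel of a morphism $\mathcal{O}_U^m\to\mathcal{O}_U^n$ with $m,n$ finite. We say that $\Gamma(X,-)$ is exact on a class of $\mathcal{O}_X$-modules if it maps every short exact sequence $0\to F_1\to F_2\to F_3\to 0$ of $\mathcal{O}_X$-modules with all three terms in the class to a short exact sequence of $A$-modules. Assume that $\varphi$ is flat, i.e. $\mathcal{O}_{X,x}$ is flat over $\mathcal{O}_{Y,\varphi(x)}$ for every $x\in X$. (1) If $A$ is Noetherian and $\Gamma(X,-)$ is exact on $A$-coherent $\mathcal{O}_X$-modules,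 then $\varphi^*G$ is $A$-coherent for every coherent $\mathcal{O}_Y$-module $G$, and $G\mapsto\varphi^*G$ is an equivalence from the category of coherent $\mathcal{O}_Y$-modules to the category of $A$-coherent $\mathcal{O}_X$-modules. (2) If $\mathcal{O}_X$ is coherent (as an $\mathcal{O}_X$-module) and $\Gamma(X,-)$ is exact on coherent $\mathcal{O}_X$-modules, then $\varphi^*G$ is $A$-coherent for every finitely presented $\mathcal{O}_Y$-module $G$, and $G\mapsto\varphi^*G$ is an equivalence from the category of finitely presented $\mathcal{O}_Y$-modules to the category of $A$-coherent $\mathcal{O}_X$-modules. -/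

import Mathlib

open CategoryTheory Limits Opposite TopologicalSpace AlgebraicGeometry

universe u

noncomputable section

namespace AlgebraicGeometry.LocallyRingedSpace

/-- The structure sheaf of a locally ringed space, as a sheaf of rings. -/
abbrev ringCatSheaf (X : LocallyRingedSpace.{u}) : TopCat.Sheaf RingCat.{u} X.carrier :=
  (sheafCompose _ (forget₂ CommRingCat.{u} RingCat.{u})).obj X.sheaf

/-- The abelian category of `𝒪_X`-modules (sheaves of modules over the structure sheaf). -/
abbrev Modules (X : LocallyRingedSpace.{u}) := SheafOfModules.{u} X.ringCatSheaf

/-- The morphism of sheaves of rings `𝒪_Y ⟶ f_* 𝒪_X` given by a morphism `f : X ⟶ Y`. -/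
def Hom.toRingCatSheafHom {X Y : LocallyRingedSpace.{u}} (f : X ⟶ Y) :
    Y.ringCatSheaf ⟶ ((Opens.map f.base).sheafPushforwardContinuous _ _ _).obj
      X.ringCatSheaf where
  hom := Functor.whiskerRight f.c _

/-- The pushforward functor of modules along a morphism of locally ringed spaces has a left
adjoint. -/
instance {X Y : LocallyRingedSpace.{u}} (f : X ⟶ Y) :
    (SheafOfModules.pushforward.{u} (Hom.toRingCatSheafHom f)).IsRightAdjoint :=
  haveI : (PresheafOfModules.pushforward.{u} (Hom.toRingCatSheafHom f).hom).IsRightAdjoint :=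
    PresheafOfModules.instIsRightAdjointPushforward.{u} (F := Opens.map f.base)
      (R := X.ringCatSheaf.obj) (S := Y.ringCatSheaf.obj) (Hom.toRingCatSheafHom f).hom
  (SheafOfModules.PullbackConstruction.adjunction.{u} (Hom.toRingCatSheafHom f)).isRightAdjoint

/-- The pullback functor `f^*` from `𝒪_Y`-modules to `𝒪_X`-modules, i.e. the left adjoint of the
pushforward functor `f_*`. -/
def pullback {X Y : LocallyRingedSpace.{u}} (f : X ⟶ Y) : Y.Modules ⥤ X.Modules :=
  SheafOfModules.pullback.{u} (Hom.toRingCatSheafHom f)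

/-- A morphism `f : X ⟶ Y` is flat if `𝒪_{X, x}` is flat over `𝒪_{Y, f x}` for all `x : X`. -/
def IsFlat {X Y : LocallyRingedSpace.{u}} (f : X ⟶ Y) : Prop :=
  ∀ x : X, (f.stalkMap x).hom.Flat

/-- An `𝒪_X`-module `F` is `A`-coherent if there is an exact sequence
`𝒪_X^m ⟶ 𝒪_X^n ⟶ F ⟶ 0` with integers `m, n ≥ 1` (here `𝒪_X^I` is indexed by finite nonempty
types instead of integers). -/
def isACoherent (X : LocallyRingedSpace.{u}) : ObjectProperty X.Modules := fun F =>
  ∃ (I J : Type u) (_ : Finite I) (_ : Finite J) (_ : Nonempty I) (_ : Nonempty J)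
    (f : (SheafOfModules.free I : X.Modules) ⟶ SheafOfModules.free J)
    (g : SheafOfModules.free J ⟶ F) (w : f ≫ g = 0),
    (ShortComplex.mk f g w).Exact ∧ Epi g

/-- An `𝒪_X`-module `F` is coherent if it is of finite type and, for every open `U` and every
morphism `𝒪_U^n ⟶ F|_U`, the kernel is an `𝒪_U`-module of finite type. -/
def isCoherent (X : LocallyRingedSpace.{u}) : ObjectProperty X.Modules := fun F =>
  F.IsFiniteType ∧
    ∀ (U : Opens X.carrier) (I : Type u) [Finite I]
      (f : (SheafOfModules.free I : SheafOfModules.{u} (X.ringCatSheaf.over U)) ⟶ F.over U),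
      (kernel f).IsFiniteType

/-- An `𝒪_X`-module is finitely presented if locally it is the cokernel of a morphism
`𝒪_U^m ⟶ 𝒪_U^n`. -/
def isFinitelyPresented (X : LocallyRingedSpace.{u}) : ObjectProperty X.Modules :=
  SheafOfModules.isFinitePresentation X.ringCatSheaf

/-- The functor `F ↦ Γ(X, F)` from `𝒪_X`-modules to `Γ(X, 𝒪_X)`-modules. -/
def globalSections (X : LocallyRingedSpace.{u}) :
    X.Modules ⥤ ModuleCat.{u} (X.ringCatSheaf.obj.obj (op (⊤ : Opens X.carrier))) :=
  SheafOfModules.evaluation X.ringCatSheaf (op ⊤)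

instance (X : LocallyRingedSpace.{u}) : X.globalSections.PreservesZeroMorphisms where
  map_zero _ _ := rfl

/-- The functor `Γ(X, -)` is exact on the `𝒪_X`-modules with property `P`: it maps every short
exact sequence `0 ⟶ F₁ ⟶ F₂ ⟶ F₃ ⟶ 0` of `𝒪_X`-modules whose terms all have property `P` to a
short exact sequence. -/
def GlobalSectionsExactOn (X : LocallyRingedSpace.{u}) (P : ObjectProperty X.Modules) : Prop :=
  ∀ S : ShortComplex X.Modules, S.ShortExact → P S.X₁ → P S.X₂ → P S.X₃ →
    (S.map X.globalSections).ShortExact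

/-- The affine scheme `Spec Γ(X, 𝒪_X)`; the canonical morphism from `X` to it is `X.toΓSpec`. -/
abbrev specΓ (X : LocallyRingedSpace.{u}) : LocallyRingedSpace.{u} :=
  Spec.locallyRingedSpaceObj (Γ.obj (op X))

/-- Given `P`, `Q` on `𝒪_Y`- and `𝒪_X`-modules, the pullback along `f : X ⟶ Y` maps modules with
property `P` to modules with property `Q`, and the resulting functor between the full
subcategories is an equivalence of categories. -/
def PullbackInducesEquivalence {X Y : LocallyRingedSpace.{u}} (f : X ⟶ Y)
    (P : ObjectProperty Y.Modules) (Q : ObjectProperty X.Modules) : Prop :=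
  ∃ h : ∀ G : P.FullSubcategory, Q ((P.ι ⋙ pullback f).obj G),
    (Q.lift (P.ι ⋙ pullback f) h).IsEquivalence

end AlgebraicGeometry.LocallyRingedSpace

end

-- Write `Y` for the spectrum of `A`. On `Y` both source categories consist of the cokernels of
-- matrices `𝒪_Y^m ⟶ 𝒪_Y^n`: local finite presentations are global ones on an affine scheme
-- (`isFinitelyPresented_spec_eq`), and if `A` is Noetherian the structure sheaf is coherent, so
-- these cokernels are exactly the coherent modules (`isCoherent_spec_eq`). The target consists of
-- the cokernels of matrices over `𝒪_X`, and `𝒪_X` and `𝒪_Y` have the same global functions, hence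
-- the same matrices.
--
-- The formal core is `pullbackInducesEquivalence_isACoherent`. It assumes that taking global
-- sections is exact on finite presentations, over `X` and over `Y`. Then the canonical map from
-- `Γ(Y, G)` to `Γ(X, φ^*G)` is bijective for free `G`, hence for presented `G` by a five lemma
-- argument. Morphisms from a presented `F` to `M` depend only on `Γ(M)`, so by adjunction `φ^*` is
-- fully faithful. It is essentially surjective because a matrix over `X` lifts to `Y` and `φ^*`
-- preserves cokernels.
--
-- Exactness on presentations holds over `Y` because sections localize. Over `X` the assumption
-- concerns short exact sequences inside a class, so the two kernels arising from a presentation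
-- must lie in that class (`rightExact_of_globalSectionsExactOn`). If `𝒪_X` is coherent, they are
-- coherent by the usual permanence properties. If `A` is Noetherian, the global relations of a
-- matrix are finitely generated, and flatness of `A ⟶ 𝒪_{X,x}` shows that they generate all local
-- relations; a presentation thus extends to the left by finite free modules (`exists_exact_free`),
-- and these present the kernels.
--
-- All finiteness conditions are handled through explicit sections, by the predicates `Spans` and
-- `GenRelations`.

universe v₁ u₁

noncomputable section

/-! ### Sections, kernels and free modules on a site -/

namespace SheafOfModules

variable {C : Type u₁} [Category.{v₁} C] {J : GrothendieckTopology C} {R : Sheaf J RingCat.{u}}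

/-- The module of sections of a sheaf of modules over an object of the site. -/
abbrev Sec (M : SheafOfModules.{u} R) (W : C) : Type u := M.val.obj (op W)

/-- The ring of sections of a sheaf of rings over an object of the site. -/
abbrev RSec (R : Sheaf J RingCat.{u}) (W : C) : Type u := R.obj.obj (op W)

/-- The restriction map of a sheaf of rings. -/
def resR (R : Sheaf J RingCat.{u}) {V W : C} (g : V ⟶ W) : RSec R W →+* RSec R V :=
  (R.obj.map g.op).hom

lemma resR_resR {U V W : C} (f : U ⟶ V) (g : V ⟶ W) (r : RSec R W) :
    resR R f (resR R g r) = resR R (f ≫ g) r :=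
  congr(($(R.obj.map_comp g.op f.op)).hom r).symm

/-- The restriction map of a sheaf of modules. -/
def res (M : SheafOfModules.{u} R) {V W : C} (g : V ⟶ W) : M.Sec W →+ M.Sec V :=
  (M.val.restrictₛₗ g.op).toAddMonoidHom

lemma res_smul (M : SheafOfModules.{u} R) {V W : C} (g : V ⟶ W) (r : RSec R W) (m : M.Sec W) :
    M.res g (r • m) = resR R g r • M.res g m :=
  M.val.map_smul g.op r m

lemma res_id (M : SheafOfModules.{u} R) (W : C) (m : M.Sec W) : M.res (𝟙 W) m = m :=
  congr(($(M.val.presheaf.map_id (op W))).hom m)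

lemma res_res (M : SheafOfModules.{u} R) {U V W : C} (f : U ⟶ V) (g : V ⟶ W) (m : M.Sec W) :
    M.res f (M.res g m) = M.res (f ≫ g) m :=
  congr(($(M.val.presheaf.map_comp g.op f.op)).hom m).symm

/-- The linear map on sections induced by a morphism of sheaves of modules. -/
def onSec {M N : SheafOfModules.{u} R} (φ : M ⟶ N) (W : C) : M.Sec W →ₗ[RSec R W] N.Sec W :=
  (φ.val.app (op W)).hom

lemma onSec_comp {M N P : SheafOfModules.{u} R} (φ : M ⟶ N) (ψ : N ⟶ P) {W : C} (t : M.Sec W) :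
    onSec (φ ≫ ψ) W t = onSec ψ W (onSec φ W t) := rfl

lemma onSec_id (M : SheafOfModules.{u} R) {W : C} (t : M.Sec W) : onSec (𝟙 M) W t = t := rfl

lemma onSec_zero {M N : SheafOfModules.{u} R} {W : C} (t : M.Sec W) :
    onSec (0 : M ⟶ N) W t = 0 := rfl

lemma onSec_res {M N : SheafOfModules.{u} R} (φ : M ⟶ N) {V W : C} (g : V ⟶ W) (t : M.Sec W) :
    onSec φ V (M.res g t) = N.res g (onSec φ W t) :=
  PresheafOfModules.naturality_apply φ.val g.op t

lemma onSec_sum {ι : Type*} [Fintype ι] {M N : SheafOfModules.{u} R} (f : ι → (M ⟶ N)) {W : C}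
    (t : M.Sec W) : onSec (∑ i, f i) W t = ∑ i, onSec (f i) W t := by
  let e : (M ⟶ N) →+ N.Sec W :=
    { toFun := fun f => onSec f W t
      map_zero' := rfl
      map_add' := fun _ _ => rfl }
  exact map_sum e f _

lemma hom_ext_sec {M N : SheafOfModules.{u} R} {φ ψ : M ⟶ N}
    (h : ∀ (W : C) (t : M.Sec W), onSec φ W t = onSec ψ W t) : φ = ψ := by
  ext W t
  exact h W.unop t

lemma sec_ext (M : SheafOfModules.{u} R) {W : C} {S : Sieve W} (hS : S ∈ J W) {a b : M.Sec W}
    (h : ∀ (V : C) (g : V ⟶ W), S g → M.res g a = M.res g b) : a = b :=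
  M.isSheaf.isSeparated W S hS (x := a) (y := b) h

/-- The value of a global section over an object. -/
def secAt {M : SheafOfModules.{u} R} (s : M.sections) (W : C) : M.Sec W := s.val (op W)

lemma res_secAt {M : SheafOfModules.{u} R} (s : M.sections) {V W : C} (g : V ⟶ W) :
    M.res g (secAt s W) = secAt s V :=
  PresheafOfModules.sections_property s g.op

lemma sections_ext' {M : SheafOfModules.{u} R} {s t : M.sections}
    (h : ∀ W, secAt s W = secAt t W) : s = t :=
  PresheafOfModules.sections_ext _ _ fun W => h W.unop

/-- Sections of the structure sheaf, seen as sections of the free module of rank one. -/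
def ofR (R : Sheaf J RingCat.{u}) (W : C) : RSec R W ≃ₗ[RSec R W] (unit R).Sec W :=
  LinearEquiv.refl _ _

lemma res_ofR {V W : C} (g : V ⟶ W) (r : RSec R W) :
    (unit R).res g (ofR R W r) = ofR R V (resR R g r) := rfl

section

variable [HasSheafify J AddCommGrpCat.{u}] [J.WEqualsLocallyBijective AddCommGrpCat.{u}]

/-- The presheaf cokernel of `φ` maps to its sheafification, and the composite from `N` vanishes
because `φ` is epi. The unit of sheafification is locally injective, so the class of `t` in the
presheaf cokernel is locally zero, that is, `t` locally has a preimage. -/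
lemma exists_locally_mem_range_of_epi {M N : SheafOfModules.{u} R} (φ : M ⟶ N) [Epi φ] (W : C)
    (t : N.Sec W) : ∃ S ∈ J W, ∀ (V : C) (g : V ⟶ W), S g → ∃ m, onSec φ V m = N.res g t := by
  let Q : PresheafOfModules R.obj := cokernel φ.val
  let c : N.val ⟶ Q := cokernel.π φ.val
  let η := (PresheafOfModules.sheafificationAdjunction (𝟙 R.obj)).unit.app Q
  let ψ : N ⟶ (PresheafOfModules.sheafification (𝟙 R.obj)).obj Q := ⟨c ≫ η⟩
  have hψ : ψ = 0 := by
    rw [← cancel_epi φ, comp_zero]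
    ext1
    change φ.val ≫ cokernel.π φ.val ≫ η = 0
    rw [cokernel.condition_assoc, zero_comp]
  have hinj : Presheaf.IsLocallyInjective J ((PresheafOfModules.toPresheaf _).map η) :=
    inferInstanceAs (Presheaf.IsLocallyInjective J (CategoryTheory.toSheafify J Q.presheaf))
  have h0 : ((PresheafOfModules.toPresheaf _).map η).app (op W) (c.app _ t) =
      ((PresheafOfModules.toPresheaf _).map η).app (op W) 0 := by
    rw [map_zero]
    exact congr(onSec $hψ W t)
  refine ⟨_, hinj.equalizerSieve_mem _ _ h0, fun V g hg => ?_⟩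
  have hg' : Q.map g.op (c.app _ t) = 0 :=
    (hg : Q.map g.op (c.app _ t) = Q.map g.op 0).trans (map_zero _)
  have hg'' : c.app (op V) (N.res g t) = 0 :=
    (PresheafOfModules.naturality_apply c g.op t).trans hg'
  have hex : ((ShortComplex.mk φ.val c (cokernel.condition _)).map
      (PresheafOfModules.evaluation R.obj (op V))).Exact :=
    (ShortComplex.exact_cokernel φ.val).map _
  rw [ShortComplex.moduleCat_exact_iff] at hex
  exact hex _ hg''

omit [HasSheafify J AddCommGrpCat.{u}] [J.WEqualsLocallyBijective AddCommGrpCat.{u}] in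
lemma epi_of_locally_mem_range {M N : SheafOfModules.{u} R} (φ : M ⟶ N)
    (h : ∀ (W : C) (t : N.Sec W),
      ∃ S ∈ J W, ∀ (V : C) (g : V ⟶ W), S g → ∃ m, onSec φ V m = N.res g t) : Epi φ where
  left_cancellation {P} a b hab := by
    refine hom_ext_sec fun W t => ?_
    obtain ⟨S, hS, hm⟩ := h W t
    refine P.sec_ext hS fun V g hg => ?_
    obtain ⟨m, hm⟩ := hm V g hg
    rw [← onSec_res, ← onSec_res, ← hm]
    exact congr(onSec $hab V m)

omit [HasSheafify J AddCommGrpCat.{u}] [J.WEqualsLocallyBijective AddCommGrpCat.{u}] in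
lemma onSec_kernel_ι_injective {M N : SheafOfModules.{u} R} (φ : M ⟶ N) (W : C) :
    Function.Injective (onSec (kernel.ι φ) W) := by
  have : Mono ((evaluation R (op W)).map (kernel.ι φ)) := inferInstance
  exact (ModuleCat.mono_iff_injective _).mp this

lemma exists_onSec_kernel_ι_eq {M N : SheafOfModules.{u} R} (φ : M ⟶ N) {W : C}
    (t : M.Sec W) (ht : onSec φ W t = 0) : ∃ t', onSec (kernel.ι φ) W t' = t := by
  have : (evaluation R (op W)).PreservesZeroMorphisms := ⟨fun _ _ => rfl⟩
  have hex : ((ShortComplex.mk (kernel.ι φ) φ (kernel.condition _)).map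
      (evaluation R (op W))).Exact :=
    (ShortComplex.exact_kernel φ).map_of_mono_of_preservesKernel _ inferInstance inferInstance
  rw [ShortComplex.moduleCat_exact_iff] at hex
  exact hex _ ht

omit [HasSheafify J AddCommGrpCat.{u}] [J.WEqualsLocallyBijective AddCommGrpCat.{u}] in
lemma onSec_onSec_kernel_ι {M N : SheafOfModules.{u} R} (φ : M ⟶ N) {W : C} (t) :
    onSec φ W (onSec (kernel.ι φ) W t) = 0 :=
  congr(onSec $(kernel.condition φ) W t)

lemma exists_locally_of_exact {S : ShortComplex (SheafOfModules.{u} R)} (hS : S.Exact) (W : C)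
    (t : S.X₂.Sec W) (ht : onSec S.g W t = 0) :
    ∃ T ∈ J W, ∀ (V : C) (g : V ⟶ W), T g → ∃ m, onSec S.f V m = S.X₂.res g t := by
  obtain ⟨t', rfl⟩ := exists_onSec_kernel_ι_eq S.g t ht
  have : Epi (kernel.lift S.g S.f S.zero) := (S.exact_iff_epi_kernel_lift).mp hS
  obtain ⟨T, hT, h⟩ := exists_locally_mem_range_of_epi (kernel.lift S.g S.f S.zero) W t'
  refine ⟨T, hT, fun V g hg => ?_⟩
  obtain ⟨m, hm⟩ := h V g hg
  refine ⟨m, ?_⟩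
  rw [← onSec_res, ← hm, ← onSec_comp, kernel.lift_ι]

lemma exact_of_locally {S : ShortComplex (SheafOfModules.{u} R)} (h : ∀ (W : C)
    (t : S.X₂.Sec W), onSec S.g W t = 0 →
    ∃ T ∈ J W, ∀ (V : C) (g : V ⟶ W), T g → ∃ m, onSec S.f V m = S.X₂.res g t) : S.Exact := by
  rw [S.exact_iff_epi_kernel_lift]
  refine epi_of_locally_mem_range _ fun W t => ?_
  obtain ⟨T, hT, h⟩ := h W _ (onSec_onSec_kernel_ι S.g t)
  refine ⟨T, hT, fun V g hg => ?_⟩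
  obtain ⟨m, hm⟩ := h V g hg
  refine ⟨m, onSec_kernel_ι_injective _ _ ?_⟩
  rw [onSec_res, ← hm, ← onSec_comp, kernel.lift_ι]

section Free

variable {ι : Type u}

/-- The `i`-th coordinate of a free sheaf of modules. -/
def freeCoord (i : ι) : (free ι : SheafOfModules.{u} R) ⟶ unit R :=
  open Classical in
  Cofan.IsColimit.desc (isColimitFreeCofan ι) fun j => if j = i then 𝟙 _ else 0

lemma ιFree_freeCoord (i j : ι) [Decidable (j = i)] :
    ιFree (R := R) j ≫ freeCoord i = if j = i then 𝟙 _ else 0 := by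
  refine (Cofan.IsColimit.fac (isColimitFreeCofan (R := R) ι) _ j).trans ?_
  congr

variable [Fintype ι]

lemma sum_freeCoord_ιFree :
    (∑ i : ι, freeCoord (R := R) i ≫ ιFree i : free ι ⟶ free ι) = 𝟙 (free ι) := by
  classical
  refine Cofan.IsColimit.hom_ext (isColimitFreeCofan ι) _ _ fun j => ?_
  change ιFree j ≫ (∑ i : ι, freeCoord (R := R) i ≫ ιFree i : free ι ⟶ free ι) =
    ιFree j ≫ 𝟙 (free ι)
  rw [Preadditive.comp_sum, Category.comp_id]
  simp [← Category.assoc, ιFree_freeCoord, ite_comp]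

/-- The section of a free sheaf of modules with given coordinates. -/
def freeMk {W : C} (c : ι → RSec R W) : (free ι : SheafOfModules.{u} R).Sec W :=
  ∑ i, onSec (ιFree (R := R) i) W (ofR R W (c i))

lemma onSec_freeMk {M : SheafOfModules.{u} R} (φ : free ι ⟶ M) {W : C} (c : ι → RSec R W) :
    onSec φ W (freeMk c) = ∑ i, c i • secAt (M.freeHomEquiv φ i) W := by
  rw [freeMk, map_sum]
  refine Finset.sum_congr rfl fun i _ => ?_
  change onSec (ιFree i ≫ φ) W (ofR R W (c i)) = c i • onSec (ιFree i ≫ φ) W (ofR R W 1)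
  rw [← map_smul, ← map_smul, smul_eq_mul, mul_one]

lemma onSec_freeCoord_freeMk {W : C} (c : ι → RSec R W) (i : ι) :
    onSec (freeCoord (R := R) i) W (freeMk c) = ofR R W (c i) := by
  classical
  rw [freeMk, map_sum, Finset.sum_eq_single i]
  · rw [← onSec_comp, ιFree_freeCoord, if_pos rfl, onSec_id]
  · intro j _ hj
    rw [← onSec_comp, ιFree_freeCoord, if_neg hj, onSec_zero]
  · simp

lemma freeMk_onSec_freeCoord {W : C} (t : (free ι : SheafOfModules.{u} R).Sec W) :
    freeMk (fun i => (ofR R W).symm (onSec (freeCoord (R := R) i) W t)) = t := by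
  refine Eq.trans ?_ (congr(onSec $(sum_freeCoord_ιFree (R := R) (ι := ι)) W t))
  rw [onSec_sum]
  rfl

lemma freeMk_surjective {W : C} (t : (free ι : SheafOfModules.{u} R).Sec W) :
    ∃ c, freeMk c = t := ⟨_, freeMk_onSec_freeCoord t⟩

lemma freeMk_injective {W : C} :
    Function.Injective (freeMk (R := R) (ι := ι) (W := W)) := fun a b h => by
  ext i
  apply (ofR R W).injective
  rw [← onSec_freeCoord_freeMk a, h, onSec_freeCoord_freeMk]

lemma res_freeMk {V W : C} (g : V ⟶ W) (c : ι → RSec R W) :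
    (free ι : SheafOfModules.{u} R).res g (freeMk c) = freeMk fun i => resR R g (c i) := by
  rw [freeMk, map_sum]
  exact Finset.sum_congr rfl fun i _ => (onSec_res (ιFree (R := R) i) g (ofR R W (c i))).symm

end Free

end

end SheafOfModules

/-! ### Generators and relations in terms of sections -/

namespace SheafOfModules

variable {C : Type u₁} [Category.{v₁} C] {J : GrothendieckTopology C} {R : Sheaf J RingCat.{u}}

/-- A finite family of sections over `Z` spans if it generates the restriction of the sheaf of
modules to `Z`. -/
def Spans (M : SheafOfModules.{u} R) {Z : C} {ι : Type u} [Fintype ι] (s : ι → M.Sec Z) : Prop :=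
  ∀ (W : C) (f : W ⟶ Z) (t : M.Sec W), ∃ S ∈ J W, ∀ (V : C) (g : V ⟶ W), S g →
    ∃ c : ι → RSec R V, ∑ i, c i • M.res (g ≫ f) (s i) = M.res g t

/-- A finite family of relations between sections over `Z` generates all relations between the
restrictions of these sections. -/
def GenRelations (M : SheafOfModules.{u} R) {Z : C} {ι κ : Type u} [Fintype ι] [Fintype κ]
    (s : ι → M.Sec Z) (ρ : κ → ι → RSec R Z) : Prop :=
  (∀ k, ∑ i, ρ k i • s i = 0) ∧
    ∀ (W : C) (f : W ⟶ Z) (r : ι → RSec R W), ∑ i, r i • M.res f (s i) = 0 →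
      ∃ S ∈ J W, ∀ (V : C) (g : V ⟶ W), S g →
        ∃ c : κ → RSec R V, ∀ i, resR R g (r i) = ∑ k, c k * resR R (g ≫ f) (ρ k i)

section Over

/-- Covering sieves of an object of the slice are covering sieves of its source. Conditions on a
restriction `M.over U` thereby become conditions on `M`. -/
lemma exists_over_covering_iff {U : C} (W : Over U)
    (p : ∀ (V : C), (V ⟶ W.left) → Prop) :
    (∃ S ∈ J.over U W, ∀ (V : Over U) (g : V ⟶ W), S g → p V.left g.left) ↔
    ∃ S ∈ J W.left, ∀ (V : C) (g : V ⟶ W.left), S g → p V g := by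
  constructor
  · rintro ⟨S, hS, h⟩
    refine ⟨_, hS, fun V g hg => ?_⟩
    rw [Sieve.overEquiv_iff] at hg
    exact h _ _ hg
  · rintro ⟨S, hS, h⟩
    exact ⟨(Sieve.overEquiv W).symm S, J.overEquiv_symm_mem_over W S hS,
      fun V g hg => h _ _ hg⟩

variable (M : SheafOfModules.{u} R) {U : C} {ι κ : Type u} [Fintype ι] [Fintype κ]

lemma spans_over_iff (Z : Over U) (s : ι → M.Sec Z.left) :
    Spans (M.over U) (Z := Z) s ↔ Spans M s := by
  constructor
  · intro h W f t
    exact (exists_over_covering_iff (Over.mk (f ≫ Z.hom)) fun V g =>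
      ∃ c : ι → RSec R V, ∑ i, c i • M.res (g ≫ f) (s i) = M.res g t).mp
        (h (Over.mk (f ≫ Z.hom)) (Over.homMk f) t)
  · intro h W f t
    exact (exists_over_covering_iff W fun V g =>
      ∃ c : ι → RSec R V, ∑ i, c i • M.res (g ≫ f.left) (s i) = M.res g t).mpr (h W.left f.left t)

lemma genRelations_over_iff (Z : Over U) (s : ι → M.Sec Z.left) (ρ : κ → ι → RSec R Z.left) :
    GenRelations (M.over U) (Z := Z) s ρ ↔ GenRelations M s ρ := by
  refine and_congr Iff.rfl ⟨fun h W f r hr => ?_, fun h W f r hr => ?_⟩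
  · exact (exists_over_covering_iff (Over.mk (f ≫ Z.hom)) fun V g =>
      ∃ c : κ → RSec R V, ∀ i, resR R g (r i) = ∑ k, c k * resR R (g ≫ f) (ρ k i)).mp
        (h (Over.mk (f ≫ Z.hom)) (Over.homMk f) r hr)
  · exact (exists_over_covering_iff W fun V g =>
      ∃ c : κ → RSec R V, ∀ i, resR R g (r i) = ∑ k, c k * resR R (g ≫ f.left) (ρ k i)).mpr
        (h W.left f.left r hr)

end Over

section Terminal

variable {T : C} (hT : IsTerminal T)

/-- The global section determined by its value over a terminal object. -/
def mkSection (M : SheafOfModules.{u} R) (m : M.Sec T) : M.sections :=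
  PresheafOfModules.sectionsMk (fun W => M.res (hT.from W.unop) m) fun X Y f => by
    refine (M.res_res f.unop _ m).trans ?_
    rw [hT.hom_ext (f.unop ≫ hT.from X.unop) (hT.from Y.unop)]

lemma secAt_mkSection (M : SheafOfModules.{u} R) (m : M.Sec T) (W : C) :
    secAt (mkSection hT M m) W = M.res (hT.from W) m := rfl

end Terminal

variable [HasSheafify J AddCommGrpCat.{u}] [J.WEqualsLocallyBijective AddCommGrpCat.{u}]

section

variable {ι κ : Type u} [Fintype ι] [Fintype κ] {M : SheafOfModules.{u} R}

lemma epi_iff_spans (φ : free ι ⟶ M) {T : C} (hT : IsTerminal T) :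
    Epi φ ↔ Spans M (fun i => secAt (M.freeHomEquiv φ i) T) := by
  constructor
  · intro _ W f t
    obtain ⟨S, hS, h⟩ := exists_locally_mem_range_of_epi φ W t
    refine ⟨S, hS, fun V g hg => ?_⟩
    obtain ⟨m, hm⟩ := h V g hg
    obtain ⟨c, rfl⟩ := freeMk_surjective m
    refine ⟨c, ?_⟩
    rw [← hm, onSec_freeMk]
    simp only [res_secAt]
  · intro h
    refine epi_of_locally_mem_range φ fun W t => ?_
    obtain ⟨S, hS, h⟩ := h W (hT.from W) t
    refine ⟨S, hS, fun V g hg => ?_⟩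
    obtain ⟨c, hc⟩ := h V g hg
    refine ⟨freeMk c, ?_⟩
    rw [← hc, onSec_freeMk]
    simp only [res_secAt]

lemma exists_kernel_coords (φ : free ι ⟶ M) {W : C} (t : (kernel φ).Sec W) :
    ∃ r : ι → RSec R W, onSec (kernel.ι φ) W t = freeMk r ∧
      ∑ i, r i • secAt (M.freeHomEquiv φ i) W = 0 := by
  obtain ⟨r, hr⟩ := freeMk_surjective (onSec (kernel.ι φ) W t)
  refine ⟨r, hr.symm, ?_⟩
  rw [← onSec_freeMk, hr, onSec_onSec_kernel_ι]

lemma exists_kernel_of_coords (φ : free ι ⟶ M) {W : C} (r : ι → RSec R W)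
    (hr : ∑ i, r i • secAt (M.freeHomEquiv φ i) W = 0) :
    ∃ t : (kernel φ).Sec W, onSec (kernel.ι φ) W t = freeMk r :=
  exists_onSec_kernel_ι_eq φ _ (by rw [onSec_freeMk, hr])

lemma freeMk_sum {W : C} (c : κ → RSec R W) (r : κ → ι → RSec R W) :
    ∑ k, c k • freeMk (r k) = freeMk fun i => ∑ k, c k * r k i := by
  simp only [freeMk, Finset.smul_sum, map_sum]
  rw [Finset.sum_comm]
  refine Finset.sum_congr rfl fun i _ => Finset.sum_congr rfl fun k _ => ?_
  rw [← map_smul, ← map_smul, smul_eq_mul]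

lemma onSec_kernel_ι_sum (φ : free ι ⟶ M) {Z V : C} (f : V ⟶ Z) (k : κ → (kernel φ).Sec Z)
    (ρ : κ → ι → RSec R Z) (hk : ∀ a, onSec (kernel.ι φ) Z (k a) = freeMk (ρ a))
    (c : κ → RSec R V) :
    onSec (kernel.ι φ) V (∑ a, c a • (kernel φ).res f (k a)) =
      freeMk fun i => ∑ a, c a * resR R f (ρ a i) := by
  rw [map_sum, ← freeMk_sum]
  refine Finset.sum_congr rfl fun a _ => ?_
  rw [map_smul, onSec_res, hk, res_freeMk]

/-- A section of the kernel of `free ι ⟶ M` is a vector of coefficients of a relation between the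
images of the basis, so generators of the kernel are generators of the relations. -/
lemma spans_kernel_iff (φ : free ι ⟶ M) {Z : C} (k : κ → (kernel φ).Sec Z)
    (ρ : κ → ι → RSec R Z) (hk : ∀ a, onSec (kernel.ι φ) Z (k a) = freeMk (ρ a)) :
    Spans (kernel φ) k ↔ GenRelations M (fun i => secAt (M.freeHomEquiv φ i) Z) ρ := by
  constructor
  · refine fun h => ⟨fun a => ?_, fun W f r hr => ?_⟩
    · rw [← onSec_freeMk, ← hk, onSec_onSec_kernel_ι]
    · simp only [res_secAt] at hr
      obtain ⟨t, ht⟩ := exists_kernel_of_coords φ r hr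
      obtain ⟨S, hS, h⟩ := h W f t
      refine ⟨S, hS, fun V g hg => ?_⟩
      obtain ⟨c, hc⟩ := h V g hg
      refine ⟨c, fun i => ?_⟩
      have := congr(onSec (kernel.ι φ) V $hc)
      rw [onSec_kernel_ι_sum φ _ k ρ hk, onSec_res, ht, res_freeMk] at this
      exact (congrFun (freeMk_injective this) i).symm
  · rintro ⟨h0, h⟩ W f t
    obtain ⟨r, ht, hr⟩ := exists_kernel_coords φ t
    obtain ⟨S, hS, h⟩ := h W f r (by simpa only [res_secAt] using hr)
    refine ⟨S, hS, fun V g hg => ?_⟩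
    obtain ⟨c, hc⟩ := h V g hg
    refine ⟨c, onSec_kernel_ι_injective φ V ?_⟩
    rw [onSec_kernel_ι_sum φ _ k ρ hk, onSec_res, ht, res_freeMk]
    simp only [hc]

lemma exists_spans_kernel_iff (φ : free ι ⟶ M) (Z : C) :
    (∃ k : κ → (kernel φ).Sec Z, Spans (kernel φ) k) ↔
      ∃ ρ : κ → ι → RSec R Z, GenRelations M (fun i => secAt (M.freeHomEquiv φ i) Z) ρ := by
  constructor
  · rintro ⟨k, h⟩
    choose ρ hk _ using fun a => exists_kernel_coords φ (k a)
    exact ⟨ρ, (spans_kernel_iff φ k ρ hk).mp h⟩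
  · rintro ⟨ρ, h⟩
    choose k hk using fun a => exists_kernel_of_coords φ (ρ a) (h.1 a)
    exact ⟨k, (spans_kernel_iff φ k ρ hk).mpr h⟩

lemma exists_generatingSections_iff {T : C} (hT : IsTerminal T) :
    (∃ σ : M.GeneratingSections, σ.IsFiniteType) ↔
      ∃ (ι : Type u) (_ : Fintype ι) (s : ι → M.Sec T), Spans M s := by
  constructor
  · rintro ⟨σ, hσ⟩
    have := Fintype.ofFinite σ.I
    refine ⟨σ.I, this, _, (epi_iff_spans σ.π hT).mp inferInstance⟩
  · rintro ⟨ι, _, s, hs⟩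
    refine ⟨⟨ι, fun i => mkSection hT M (s i), (epi_iff_spans _ hT).mpr ?_⟩,
      ⟨Finite.of_fintype ι⟩⟩
    convert hs with i
    rw [Equiv.apply_symm_apply, secAt_mkSection, hT.hom_ext (hT.from T) (𝟙 T), res_id]

lemma exists_presentation_iff {T : C} (hT : IsTerminal T) :
    (∃ σ : M.Presentation, σ.IsFinite) ↔
      ∃ (ι : Type u) (_ : Fintype ι) (s : ι → M.Sec T) (κ : Type u) (_ : Fintype κ)
        (ρ : κ → ι → RSec R T), Spans M s ∧ GenRelations M s ρ := by
  constructor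
  · rintro ⟨σ, hσ⟩
    have := Fintype.ofFinite σ.generators.I
    obtain ⟨κ, _, k, hk⟩ := (exists_generatingSections_iff hT).mp
      ⟨σ.relations, hσ.isFiniteType_relations⟩
    obtain ⟨ρ, hρ⟩ := (exists_spans_kernel_iff σ.generators.π T).mp ⟨k, hk⟩
    exact ⟨_, this, _, κ, _, ρ, (epi_iff_spans σ.generators.π hT).mp inferInstance, hρ⟩
  · rintro ⟨ι, _, s, κ, _, ρ, hs, hρ⟩
    have hs' : (fun i => secAt (M.freeHomEquiv
        (M.freeHomEquiv.symm fun i => mkSection hT M (s i)) i) T) = s := by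
      ext i
      rw [Equiv.apply_symm_apply, secAt_mkSection, hT.hom_ext (hT.from T) (𝟙 T), res_id]
    let σ : M.GeneratingSections := ⟨ι, fun i => mkSection hT M (s i),
      (epi_iff_spans _ hT).mpr (by rwa [hs'])⟩
    obtain ⟨k, hk⟩ := (exists_spans_kernel_iff (κ := κ) (ι := ι) σ.π T).mpr
      ⟨ρ, by rwa [hs']⟩
    obtain ⟨τ, hτ⟩ := (exists_generatingSections_iff (M := kernel σ.π) hT).mpr ⟨κ, _, k, hk⟩
    exact ⟨⟨σ, τ⟩, ⟨⟨Finite.of_fintype ι⟩, hτ⟩⟩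

end

section

variable [∀ X, HasSheafify (J.over X) AddCommGrpCat.{u}]
  [∀ X, (J.over X).WEqualsLocallyBijective AddCommGrpCat.{u}]
  (M : SheafOfModules.{u} R)

omit [HasSheafify J AddCommGrpCat.{u}] [J.WEqualsLocallyBijective AddCommGrpCat.{u}] in
lemma isFiniteType_iff_exists_spans :
    M.IsFiniteType ↔ ∃ (I : Type u₁) (Z : I → C), J.CoversTop Z ∧ ∀ a,
      ∃ (κ : Type u) (_ : Fintype κ) (k : κ → M.Sec (Z a)), Spans M k := by
  have key (Z : C) : (∃ σ : (M.over Z).GeneratingSections, σ.IsFiniteType) ↔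
      ∃ (κ : Type u) (_ : Fintype κ) (k : κ → M.Sec Z), Spans M k :=
    (exists_generatingSections_iff (M := M.over Z) Over.mkIdTerminal).trans
      (exists_congr fun κ => exists_congr fun _ => exists_congr fun k =>
        spans_over_iff M (Over.mk (𝟙 Z)) k)
  constructor
  · rintro ⟨σ, hσ⟩
    exact ⟨σ.I, σ.X, σ.coversTop, fun a => (key _).mp ⟨σ.generators a, hσ.isFiniteType a⟩⟩
  · rintro ⟨I, Z, hZ, h⟩
    choose σ hσ using fun a => (key _).mpr (h a)
    exact ⟨⟨I, Z, hZ, σ⟩, ⟨hσ⟩⟩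

omit [HasSheafify J AddCommGrpCat.{u}] [J.WEqualsLocallyBijective AddCommGrpCat.{u}] in
lemma isFinitePresentation_iff_exists_spans :
    M.IsFinitePresentation ↔ ∃ (I : Type u₁) (Z : I → C), J.CoversTop Z ∧ ∀ a,
      ∃ (ι : Type u) (_ : Fintype ι) (s : ι → M.Sec (Z a)) (κ : Type u) (_ : Fintype κ)
        (ρ : κ → ι → RSec R (Z a)), Spans M s ∧ GenRelations M s ρ := by
  have key (Z : C) : (∃ σ : (M.over Z).Presentation, σ.IsFinite) ↔
      ∃ (ι : Type u) (_ : Fintype ι) (s : ι → M.Sec Z) (κ : Type u) (_ : Fintype κ)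
        (ρ : κ → ι → RSec R Z), Spans M s ∧ GenRelations M s ρ :=
    (exists_presentation_iff (M := M.over Z) Over.mkIdTerminal).trans
      (exists_congr fun ι => exists_congr fun _ => exists_congr fun s =>
        exists_congr fun κ => exists_congr fun _ => exists_congr fun ρ =>
        and_congr (spans_over_iff M (Over.mk (𝟙 Z)) s)
          (genRelations_over_iff M (Over.mk (𝟙 Z)) s ρ))
  constructor
  · rintro ⟨σ, hσ⟩
    exact ⟨σ.I, σ.X, σ.coversTop, fun a => (key _).mp
      ⟨σ.presentation a, hσ.isFinite_presentation a⟩⟩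
  · rintro ⟨I, Z, hZ, h⟩
    choose σ hσ using fun a => (key _).mpr (h a)
    exact ⟨⟨I, Z, hZ, σ⟩, ⟨hσ⟩⟩

lemma isFiniteType_kernel_iff {ι : Type u} [Fintype ι] (φ : free ι ⟶ M) :
    (kernel φ).IsFiniteType ↔ ∃ (I : Type u₁) (Z : I → C), J.CoversTop Z ∧ ∀ a,
      ∃ (κ : Type u) (_ : Fintype κ) (ρ : κ → ι → RSec R (Z a)),
        GenRelations M (fun i => secAt (M.freeHomEquiv φ i) (Z a)) ρ := by
  rw [isFiniteType_iff_exists_spans]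
  simp only [exists_spans_kernel_iff]

end

end SheafOfModules

/-! ### Finiteness conditions over a topological space -/

namespace SheafOfModules

section Opens

variable {X : Type u} [TopologicalSpace X]

lemma exists_opens_covering_iff (W : Opens X) (p : ∀ V : Opens X, (V ⟶ W) → Prop)
    (hp : ∀ (V V' : Opens X) (g : V ⟶ W) (h : V' ⟶ V), p V g → p V' (h ≫ g)) :
    (∃ S ∈ Opens.grothendieckTopology X W, ∀ (V : Opens X) (g : V ⟶ W), S g → p V g) ↔
      ∀ x ∈ W, ∃ (V : Opens X) (g : V ⟶ W), p V g ∧ x ∈ V := by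
  constructor
  · rintro ⟨S, hS, h⟩ x hx
    obtain ⟨V, g, hg, hxV⟩ := hS x hx
    exact ⟨V, g, h V g hg, hxV⟩
  · intro h
    -- By `hp` the inclusions satisfying `p` form a sieve, and the pointwise condition says that
    -- this sieve covers.
    exact ⟨⟨fun V g => p V g, fun hg h => hp _ _ _ h hg⟩, h, fun V g hg => hg⟩

variable {R : Sheaf (Opens.grothendieckTopology X) RingCat.{u}} (M : SheafOfModules.{u} R)
  {ι κ : Type u} [Fintype ι] [Fintype κ] {Z : Opens X}

lemma spans_iff_forall_mem (s : ι → M.Sec Z) : Spans M s ↔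
    ∀ (W : Opens X) (f : W ⟶ Z) (t : M.Sec W), ∀ x ∈ W, ∃ (V : Opens X) (g : V ⟶ W),
      (∃ c : ι → RSec R V, ∑ i, c i • M.res (g ≫ f) (s i) = M.res g t) ∧ x ∈ V := by
  refine forall_congr' fun W => forall_congr' fun f => forall_congr' fun t =>
    exists_opens_covering_iff W (fun V g => ∃ c : ι → RSec R V,
      ∑ i, c i • M.res (g ≫ f) (s i) = M.res g t) ?_
  rintro V V' g h ⟨c, hc⟩
  refine ⟨fun i => resR R h (c i), ?_⟩
  rw [← M.res_res, ← hc, map_sum]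
  simp only [res_smul, res_res, Category.assoc]

lemma genRelations_iff_forall_mem (s : ι → M.Sec Z) (ρ : κ → ι → RSec R Z) :
    GenRelations M s ρ ↔ (∀ k, ∑ i, ρ k i • s i = 0) ∧
    ∀ (W : Opens X) (f : W ⟶ Z) (r : ι → RSec R W), ∑ i, r i • M.res f (s i) = 0 →
      ∀ x ∈ W, ∃ (V : Opens X) (g : V ⟶ W),
        (∃ c : κ → RSec R V, ∀ i, resR R g (r i) = ∑ k, c k * resR R (g ≫ f) (ρ k i)) ∧
          x ∈ V := by
  refine and_congr Iff.rfl (forall_congr' fun W => forall_congr' fun f => forall_congr' fun r =>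
    imp_congr Iff.rfl (exists_opens_covering_iff W (fun V g =>
      ∃ c : κ → RSec R V, ∀ i, resR R g (r i) = ∑ k, c k * resR R (g ≫ f) (ρ k i)) ?_))
  rintro V V' g h ⟨c, hc⟩
  refine ⟨fun k => resR R h (c k), fun i => ?_⟩
  rw [← resR_resR, hc, map_sum]
  simp only [map_mul, resR_resR, Category.assoc]

variable {M} in
lemma Spans.restrict {s : ι → M.Sec Z} (h : Spans M s) {V : Opens X} (g : V ⟶ Z) :
    Spans M (fun i => M.res g (s i)) := fun W f t => by
  simpa only [res_res, Category.assoc] using h W (f ≫ g) t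

variable {M} in
lemma GenRelations.restrict {s : ι → M.Sec Z} {ρ : κ → ι → RSec R Z} (h : GenRelations M s ρ)
    {V : Opens X} (g : V ⟶ Z) :
    GenRelations M (fun i => M.res g (s i)) (fun k i => resR R g (ρ k i)) := by
  refine ⟨fun k => ?_, fun W f r hr => ?_⟩
  · simpa only [map_sum, res_smul, map_zero] using congr(M.res g $(h.1 k))
  · simpa only [resR_resR, Category.assoc] using h.2 W (f ≫ g) r (by simpa only [res_res] using hr)

/-- A sheaf of modules is locally generated by finitely many sections. -/
def LocallyFG : Prop := ∀ x : X, ∃ Z : Opens X, x ∈ Z ∧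
  ∃ (κ : Type u) (_ : Fintype κ) (k : κ → M.Sec Z), Spans M k

/-- The relations between finitely many sections are locally finitely generated. -/
def RelationsFG : Prop := ∀ (U : Opens X) (ι : Type u) (_ : Fintype ι) (s : ι → M.Sec U),
  ∀ x ∈ U, ∃ (V : Opens X) (g : V ⟶ U), x ∈ V ∧
    ∃ (κ : Type u) (_ : Fintype κ) (ρ : κ → ι → RSec R V),
      GenRelations M (fun i => M.res g (s i)) ρ

/-- A sheaf of modules locally has finitely many generators and relations. -/
def LocallyFP : Prop := ∀ x : X, ∃ Z : Opens X, x ∈ Z ∧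
  ∃ (ι : Type u) (_ : Fintype ι) (s : ι → M.Sec Z) (κ : Type u) (_ : Fintype κ)
    (ρ : κ → ι → RSec R Z), Spans M s ∧ GenRelations M s ρ

lemma exists_coversTop_opens_iff (p : Opens X → Prop) :
    (∃ (I : Type u) (Z : I → Opens X), (Opens.grothendieckTopology X).CoversTop Z ∧ ∀ a, p (Z a)) ↔
      ∀ x : X, ∃ Z : Opens X, x ∈ Z ∧ p Z := by
  constructor
  · rintro ⟨I, Z, hZ, h⟩ x
    obtain ⟨V, g, ⟨a, ⟨ha⟩⟩, hxV⟩ := hZ ⊤ x trivial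
    exact ⟨Z a, leOfHom ha hxV, h a⟩
  · intro h
    choose Z hZ hp using h
    exact ⟨X, Z, fun W x hx => ⟨W ⊓ Z x, homOfLE inf_le_left,
      ⟨x, ⟨homOfLE inf_le_right⟩⟩, hx, hZ x⟩, hp⟩

lemma exists_coversTop_over_iff (U : Opens X) (p : Opens X → Prop) :
    (∃ (I : Type u) (Z : I → Over U), ((Opens.grothendieckTopology X).over U).CoversTop Z ∧
      ∀ a, p (Z a).left) ↔ ∀ x ∈ U, ∃ (V : Opens X) (_ : V ⟶ U), x ∈ V ∧ p V := by
  constructor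
  · rintro ⟨I, Z, hZ, h⟩ x hx
    obtain ⟨V, g, hg, hxV⟩ := (GrothendieckTopology.mem_over_iff _ _).mp (hZ (Over.mk (𝟙 U))) x hx
    rw [Sieve.overEquiv_iff] at hg
    obtain ⟨a, ⟨ha⟩⟩ := hg
    exact ⟨(Z a).left, (Z a).hom, leOfHom ha.left hxV, h a⟩
  · intro h
    choose Z f hZ hp using h
    refine ⟨U, fun x => Over.mk (f x.1 x.2), fun W => ?_, fun x => hp x.1 x.2⟩
    rw [GrothendieckTopology.mem_over_iff]
    intro x hx
    have hxU : x ∈ U := leOfHom W.hom hx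
    refine ⟨W.left ⊓ Z x hxU, homOfLE inf_le_left, ?_, hx, hZ x hxU⟩
    rw [Sieve.overEquiv_iff]
    exact ⟨⟨x, hxU⟩, ⟨Over.homMk (homOfLE inf_le_right)⟩⟩

lemma isFiniteType_iff_locallyFG : M.IsFiniteType ↔ LocallyFG M :=
  (isFiniteType_iff_exists_spans M).trans (exists_coversTop_opens_iff fun Z =>
    ∃ (κ : Type u) (_ : Fintype κ) (k : κ → M.Sec Z), Spans M k)

lemma isFinitePresentation_iff_locallyFP : M.IsFinitePresentation ↔ LocallyFP M :=
  (isFinitePresentation_iff_exists_spans M).trans (exists_coversTop_opens_iff fun Z =>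
    ∃ (ι : Type u) (_ : Fintype ι) (s : ι → M.Sec Z) (κ : Type u) (_ : Fintype κ)
      (ρ : κ → ι → RSec R Z), Spans M s ∧ GenRelations M s ρ)

lemma isFiniteType_kernel_iff_locally (φ : free ι ⟶ M) :
    (kernel φ).IsFiniteType ↔ ∀ x : X, ∃ Z : Opens X, x ∈ Z ∧
      ∃ (κ : Type u) (_ : Fintype κ) (ρ : κ → ι → RSec R Z),
        GenRelations M (fun i => secAt (M.freeHomEquiv φ i) Z) ρ :=
  (isFiniteType_kernel_iff M φ).trans (exists_coversTop_opens_iff fun Z =>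
    ∃ (κ : Type u) (_ : Fintype κ) (ρ : κ → ι → RSec R Z),
      GenRelations M (fun i => secAt (M.freeHomEquiv φ i) Z) ρ)

variable {M} in
/-- The section over `U` determined by a global section of the restriction to `U`. -/
def overTop {U : Opens X} (s : (M.over U).sections) : M.Sec U := secAt s (Over.mk (𝟙 U))

/-- The slice over `U` has a terminal object, so a morphism from a free module to `M.over U` is a
family of sections of `M` over `U`, and its kernel is the sheaf of their relations. -/
lemma relationsFG_iff : RelationsFG M ↔
    ∀ (U : Opens X) (I : Type u) [Finite I]
      (f : (free I : SheafOfModules.{u} (R.over U)) ⟶ M.over U), (kernel f).IsFiniteType := by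
  have key (U : Opens X) (ι : Type u) [Fintype ι]
      (f : (free ι : SheafOfModules.{u} (R.over U)) ⟶ M.over U) :
      (kernel f).IsFiniteType ↔ ∀ x ∈ U, ∃ (V : Opens X) (g : V ⟶ U), x ∈ V ∧
        ∃ (κ : Type u) (_ : Fintype κ) (ρ : κ → ι → RSec R V),
          GenRelations M (fun i => M.res g (overTop ((M.over U).freeHomEquiv f i))) ρ := by
    refine (isFiniteType_kernel_iff (M.over U) f).trans ?_
    have h (Z : Over U) (κ : Type u) [Fintype κ] (ρ : κ → ι → RSec R Z.left) :
        GenRelations (M.over U) (fun i => secAt ((M.over U).freeHomEquiv f i) Z) ρ ↔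
        GenRelations M (fun i => M.res Z.hom (overTop ((M.over U).freeHomEquiv f i))) ρ := by
      rw [← genRelations_over_iff M Z]
      have (i : ι) : secAt ((M.over U).freeHomEquiv f i) Z =
          M.res Z.hom (overTop ((M.over U).freeHomEquiv f i)) :=
        (res_secAt ((M.over U).freeHomEquiv f i) (Over.homMk Z.hom : Z ⟶ Over.mk (𝟙 U))).symm
      simp only [this]
    refine Iff.trans ?_ ((exists_coversTop_over_iff U fun V => ∃ (g : V ⟶ U) (κ : Type u)
      (_ : Fintype κ) (ρ : κ → ι → RSec R V), GenRelations M (fun i => M.res g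
        (overTop ((M.over U).freeHomEquiv f i))) ρ).trans ?_)
    · refine exists_congr fun I => exists_congr fun Z => and_congr Iff.rfl
        (forall_congr' fun a => ⟨?_, ?_⟩)
      · rintro ⟨κ, _, ρ, hρ⟩
        exact ⟨(Z a).hom, κ, _, ρ, (h (Z a) κ ρ).mp hρ⟩
      · rintro ⟨g, κ, _, ρ, hρ⟩
        obtain rfl : g = (Z a).hom := Subsingleton.elim _ _
        exact ⟨κ, _, ρ, (h (Z a) κ ρ).mpr hρ⟩
    · refine forall_congr' fun x => forall_congr' fun hx => exists_congr fun V => ⟨?_, ?_⟩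
      · rintro ⟨_, hxV, g, h⟩
        exact ⟨g, hxV, h⟩
      · rintro ⟨g, hxV, h⟩
        exact ⟨g, hxV, g, h⟩
  constructor
  · intro h U I _ f
    have := Fintype.ofFinite I
    exact (key U I f).mpr (h U I this _)
  · intro h U ι _ s
    have := (key U ι ((M.over U).freeHomEquiv.symm fun i =>
      mkSection Over.mkIdTerminal (M.over U) (s i))).mp (h U ι _)
    have hs (i : ι) : overTop ((M.over U).freeHomEquiv ((M.over U).freeHomEquiv.symm fun i =>
        mkSection Over.mkIdTerminal (M.over U) (s i)) i) = s i := by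
      rw [Equiv.apply_symm_apply]
      exact M.res_id U (s i)
    simpa only [hs] using this

end Opens

end SheafOfModules

namespace AlgebraicGeometry.LocallyRingedSpace

open SheafOfModules

variable {X : LocallyRingedSpace.{u}} (F : X.Modules)

lemma isCoherent_iff : X.isCoherent F ↔ LocallyFG F ∧ RelationsFG F :=
  and_congr (isFiniteType_iff_locallyFG F) (relationsFG_iff F).symm

lemma isFinitelyPresented_iff : X.isFinitelyPresented F ↔ LocallyFP F :=
  isFinitePresentation_iff_locallyFP F

lemma isFinitelyPresented_of_isCoherent (hF : X.isCoherent F) : X.isFinitelyPresented F := by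
  obtain ⟨h, h'⟩ := (isCoherent_iff F).mp hF
  rw [isFinitelyPresented_iff]
  intro x
  obtain ⟨Z, hxZ, ι, _, s, hs⟩ := h x
  obtain ⟨V, g, hxV, κ, _, ρ, hρ⟩ := h' Z ι _ s x hxZ
  exact ⟨V, hxV, ι, _, _, κ, _, ρ, hs.restrict g, hρ⟩

end AlgebraicGeometry.LocallyRingedSpace

/-! ### Permanence properties of locally generated modules and relations -/

namespace SheafOfModules

section Opens

variable {X : Type u} [TopologicalSpace X]
  {R : Sheaf (Opens.grothendieckTopology X) RingCat.{u}} {M M' M'' : SheafOfModules.{u} R}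

lemma onSec_injective_of_mono (φ : M' ⟶ M) [Mono φ] (W : Opens X) :
    Function.Injective (onSec φ W) := by
  have : Mono ((evaluation R (op W)).map φ) := inferInstance
  exact (ModuleCat.mono_iff_injective _).mp this

lemma exists_mem_range_of_epi (φ : M ⟶ M'') [Epi φ] {W : Opens X} (t : M''.Sec W) {x : X}
    (hx : x ∈ W) : ∃ (V : Opens X) (g : V ⟶ W), x ∈ V ∧ ∃ m, onSec φ V m = M''.res g t := by
  obtain ⟨S, hS, h⟩ := exists_locally_mem_range_of_epi φ W t
  obtain ⟨V, g, hg, hxV⟩ := hS x hx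
  exact ⟨V, g, hxV, h V g hg⟩

lemma exists_mem_range_of_exact {S : ShortComplex (SheafOfModules.{u} R)} (hS : S.Exact)
    {W : Opens X} (t : S.X₂.Sec W) (ht : onSec S.g W t = 0) {x : X} (hx : x ∈ W) :
    ∃ (V : Opens X) (g : V ⟶ W), x ∈ V ∧ ∃ m, onSec S.f V m = S.X₂.res g t := by
  obtain ⟨T, hT, h⟩ := exists_locally_of_exact hS W t ht
  obtain ⟨V, g, hg, hxV⟩ := hT x hx
  exact ⟨V, g, hxV, h V g hg⟩

lemma exists_common_refinement {U : Opens X} {ι : Type*} [Finite ι] {x : X} (hx : x ∈ U)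
    {p : ι → ∀ V : Opens X, (V ⟶ U) → Prop}
    (hp : ∀ (i : ι) (V V' : Opens X) (g : V ⟶ U) (h : V' ⟶ V), p i V g → p i V' (h ≫ g))
    (h : ∀ i, ∃ (V : Opens X) (g : V ⟶ U), x ∈ V ∧ p i V g) :
    ∃ (V : Opens X) (g : V ⟶ U), x ∈ V ∧ ∀ i, p i V g := by
  choose V g hxV h using h
  refine ⟨U ⊓ ⟨⋂ i, V i, isOpen_iInter_of_finite fun i => (V i).2⟩, homOfLE inf_le_left,
    ⟨hx, Set.mem_iInter.mpr hxV⟩, fun i => ?_⟩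
  exact hp i _ _ (g i) (homOfLE (inf_le_right.trans (Set.iInter_subset _ i))) (h i)

/-- Sections of `M'` satisfy the same relations as their images in `M`. -/
lemma RelationsFG.of_mono (φ : M' ⟶ M) [Mono φ] (h : RelationsFG M) : RelationsFG M' := by
  have key {W Z : Opens X} {ι : Type u} [Fintype ι] (s : ι → M'.Sec Z) (f : W ⟶ Z)
      (r : ι → RSec R W) :
      ∑ i, r i • M.res f (onSec φ Z (s i)) = 0 ↔ ∑ i, r i • M'.res f (s i) = 0 := by
    rw [← (onSec_injective_of_mono φ W).eq_iff (b := 0), map_zero, map_sum]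
    simp only [map_smul, onSec_res]
  intro U ι _ s x hx
  obtain ⟨V, g, hxV, κ, _, ρ, h0, hρ⟩ := h U ι _ (fun i => onSec φ U (s i)) x hx
  refine ⟨V, g, hxV, κ, _, ρ, fun k => (key _ _ _).mp (h0 k), fun W f r hr => hρ W f r ?_⟩
  simp only [res_res] at hr ⊢
  exact (key _ _ _).mpr hr

lemma LocallyFG.of_epi (φ : M ⟶ M'') [Epi φ] (h : LocallyFG M) : LocallyFG M'' := by
  intro x
  obtain ⟨Z, hxZ, κ, _, k, hk⟩ := h x
  refine ⟨Z, hxZ, κ, inferInstance, fun a => onSec φ Z (k a), ?_⟩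
  rw [spans_iff_forall_mem] at hk ⊢
  intro W f t y hy
  obtain ⟨V, g, hyV, m, hm⟩ := exists_mem_range_of_epi φ t hy
  obtain ⟨V', g', ⟨c, hc⟩, hyV'⟩ := hk V (g ≫ f) m y hyV
  refine ⟨V', g' ≫ g, ⟨c, ?_⟩, hyV'⟩
  rw [← res_res, ← hm, ← onSec_res, ← hc, map_sum]
  simp only [map_smul, onSec_res, Category.assoc]

lemma sum_mul_smul {W : Opens X} {ι κ : Type*} [Fintype ι] [Fintype κ] (c : κ → RSec R W)
    (r : κ → ι → RSec R W) (m : ι → M.Sec W) :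
    ∑ i, (∑ k, c k * r k i) • m i = ∑ k, c k • ∑ i, r k i • m i := by
  simp only [Finset.sum_smul, Finset.smul_sum, mul_smul]
  exact Finset.sum_comm

/-- Let `ρ` generate the relations between the images in `M''`. The combinations of the `s i` with
coefficients `ρ` come from sections `σ` of `M'`; if `τ` generates the relations between these, the
matrix product of `τ` and `ρ` generates the relations between the `s i`. -/
lemma RelationsFG.of_exact {φ : M' ⟶ M} {ψ : M ⟶ M''}
    (hφ : ∀ W, Function.Injective (onSec φ W))
    (hex : ∀ (W : Opens X) (t : M.Sec W), onSec ψ W t = 0 → ∃ m, onSec φ W m = t)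
    (h' : RelationsFG M') (h'' : RelationsFG M'') : RelationsFG M := by
  intro U ι _ s x hx
  obtain ⟨V, g, hxV, κ, _, ρ, h0, hρ⟩ := h'' U ι _ (fun i => onSec ψ U (s i)) x hx
  have hσ (k : κ) : ∃ m, onSec φ V m = ∑ i, ρ k i • M.res g (s i) := by
    refine hex V _ ?_
    rw [map_sum, ← h0 k]
    simp only [map_smul, onSec_res]
  choose σ hσ using hσ
  obtain ⟨V', g', hxV', ν, _, τ, h0', hτ⟩ := h' V κ _ σ x hxV
  refine ⟨V', g' ≫ g, hxV', ν, inferInstance, fun l i => ∑ k, τ l k * resR R g' (ρ k i), ?_⟩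
  rw [genRelations_iff_forall_mem]
  have key {W : Opens X} (f : W ⟶ V) (c : κ → RSec R W) :
      onSec φ W (∑ k, c k • M'.res f (σ k)) =
        ∑ i, (∑ k, c k * resR R f (ρ k i)) • M.res (f ≫ g) (s i) := by
    rw [sum_mul_smul, map_sum]
    refine Finset.sum_congr rfl fun k _ => ?_
    rw [map_smul, onSec_res, hσ, map_sum]
    simp only [res_smul, res_res]
  refine ⟨fun l => ?_, fun W f r hr y hy => ?_⟩
  · rw [← key, h0', map_zero]
  · have hr' : ∑ i, r i • M''.res (f ≫ g') (M''.res g (onSec ψ U (s i))) = 0 := by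
      have := congr(onSec ψ W $hr)
      rw [map_sum, map_zero] at this
      simpa only [map_smul, onSec_res, res_res, Category.assoc] using this
    obtain ⟨W₁, g₁, ⟨c, hc⟩, hy₁⟩ :=
      ((genRelations_iff_forall_mem _ _ _).mp ⟨h0, hρ⟩).2 W (f ≫ g') r hr' y hy
    have hcσ : ∑ k, c k • M'.res (g₁ ≫ f) (M'.res g' (σ k)) = 0 := by
      apply hφ
      simp only [res_res]
      rw [key, map_zero]
      have := congr(M.res g₁ $hr)
      rw [map_sum, map_zero] at this
      simpa only [res_smul, res_res, hc, Category.assoc] using this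
    obtain ⟨W₂, g₂, ⟨d, hd⟩, hy₂⟩ :=
      ((genRelations_iff_forall_mem _ _ _).mp ⟨h0', hτ⟩).2 W₁ (g₁ ≫ f) c hcσ y hy₁
    refine ⟨W₂, g₂ ≫ g₁, ⟨d, fun i => ?_⟩, hy₂⟩
    rw [← resR_resR, hc, map_sum]
    simp only [map_mul, hd, resR_resR, Finset.sum_mul, map_sum, Finset.mul_sum, Category.assoc,
      mul_assoc]
    exact Finset.sum_comm

/-- Lift the sections locally to `S.X₂` and adjoin the images of generators of `S.X₁`. The relations
in `S.X₃` are the first components of the relations of this larger family. -/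
lemma RelationsFG.of_epi {S : ShortComplex (SheafOfModules.{u} R)} (hS : S.Exact) [Epi S.g]
    (h₁ : LocallyFG S.X₁) (h₂ : RelationsFG S.X₂) : RelationsFG S.X₃ := by
  intro U ι _ s x hx
  obtain ⟨V, g, hxV, ht⟩ : ∃ (V : Opens X) (g : V ⟶ U), x ∈ V ∧
      ∀ i, ∃ m, onSec S.g V m = S.X₃.res g (s i) := by
    refine exists_common_refinement (p := fun i V g => ∃ m, onSec S.g V m = S.X₃.res g (s i)) hx
      ?_ fun i => exists_mem_range_of_epi S.g (s i) hx
    rintro i V V' g h ⟨m, hm⟩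
    exact ⟨S.X₂.res h m, by rw [onSec_res, hm, res_res]⟩
  choose t ht using ht
  obtain ⟨Z, hxZ, α, _, e, he⟩ := h₁ x
  have hxV' : x ∈ V ⊓ Z := ⟨hxV, hxZ⟩
  let a : V ⊓ Z ⟶ V := homOfLE inf_le_left
  let b : V ⊓ Z ⟶ Z := homOfLE inf_le_right
  obtain ⟨V₁, g₁, hxV₁, κ, _, ρ, hρ⟩ := h₂ (V ⊓ Z) (ι ⊕ α) inferInstance
    (Sum.elim (fun i => S.X₂.res a (t i)) fun j => onSec S.f _ (S.X₁.res b (e j))) x hxV'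
  have hfg {W : Opens X} (m : S.X₁.Sec W) : onSec S.g W (onSec S.f W m) = 0 :=
    congr(onSec $(S.zero) W m)
  have hst {W : Opens X} (f : W ⟶ V) (r : ι → RSec R W) :
      ∑ i, r i • S.X₃.res (f ≫ g) (s i) = onSec S.g W (∑ i, r i • S.X₂.res f (t i)) := by
    rw [map_sum]
    simp only [map_smul, onSec_res, ht, res_res]
  refine ⟨V₁, g₁ ≫ a ≫ g, hxV₁, κ, inferInstance, fun k i => ρ k (Sum.inl i), ?_⟩
  rw [genRelations_iff_forall_mem] at hρ ⊢
  rw [spans_iff_forall_mem] at he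
  obtain ⟨h0, hρ⟩ := hρ
  refine ⟨fun k => ?_, fun W f r hr y hy => ?_⟩
  · have := congr(onSec S.g _ $(h0 k))
    rw [Fintype.sum_sum_type, map_add, map_zero] at this
    simp only [Sum.elim_inl, Sum.elim_inr, ← onSec_res, res_res] at this
    rw [← Category.assoc, hst]
    refine Eq.trans ?_ this
    rw [left_eq_add, map_sum]
    refine Finset.sum_eq_zero fun j _ => ?_
    rw [map_smul, hfg, smul_zero]
  · have hr' : onSec S.g W (∑ i, r i • S.X₂.res (f ≫ g₁ ≫ a) (t i)) = 0 := by
      rw [← hst, ← hr]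
      simp only [res_res, Category.assoc]
    obtain ⟨W₁, f₁, hy₁, m, hm⟩ := exists_mem_range_of_exact hS _ hr' hy
    obtain ⟨W₂, f₂, ⟨c, hc⟩, hy₂⟩ := he W₁ (f₁ ≫ f ≫ g₁ ≫ b) m y hy₁
    -- The combination of the lifts with coefficients `r` is the image of a section of `S.X₁` with
    -- coefficients `c`; hence the coefficients `r` and `-c` form a relation in `S.X₂`.
    obtain ⟨W₃, f₃, ⟨d, hd⟩, hy₃⟩ := hρ W₂ (f₂ ≫ f₁ ≫ f)
      (Sum.elim (fun i => resR R (f₂ ≫ f₁) (r i)) fun j => - c j) (by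
        rw [Fintype.sum_sum_type]
        simp only [Sum.elim_inl, Sum.elim_inr, neg_smul, Finset.sum_neg_distrib]
        rw [add_neg_eq_zero]
        have := congr(onSec S.f _ $hc)
        rw [onSec_res, hm, map_sum, map_sum, map_sum] at this
        simpa only [map_smul, res_smul, res_res, resR_resR, onSec_res, Category.assoc] using
          this.symm) y hy₂
    refine ⟨W₃, f₃ ≫ f₂ ≫ f₁, ⟨d, fun i => ?_⟩, hy₃⟩
    have := hd (Sum.inl i)
    simpa only [Sum.elim_inl, resR_resR, Category.assoc] using this

lemma locallyFG_free (ι : Type u) [Fintype ι] : LocallyFG (free ι : SheafOfModules.{u} R) := by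
  intro x
  have := (epi_iff_spans (𝟙 (free ι : SheafOfModules.{u} R)) (T := (⊤ : Opens X))
    isTerminalTop).mp inferInstance
  exact ⟨⊤, trivial, ι, _, _, this⟩

lemma freeMap_comp {ι κ ν : Type u} (f : ι → κ) (g : κ → ν) :
    freeMap (R := R) f ≫ freeMap g = freeMap (g ∘ f) := by
  refine Cofan.IsColimit.hom_ext (isColimitFreeCofan (R := R) ι) _ _ fun i => ?_
  change ιFree i ≫ freeMap f ≫ freeMap g = ιFree i ≫ freeMap (g ∘ f)
  simp

lemma freeMap_id (ι : Type u) : freeMap (R := R) (id : ι → ι) = 𝟙 (free ι) := by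
  refine Cofan.IsColimit.hom_ext (isColimitFreeCofan (R := R) ι) _ _ fun i => ?_
  change ιFree i ≫ freeMap id = ιFree i ≫ 𝟙 _
  simp

lemma relationsFG_free (hR : RelationsFG (unit R)) (ι : Type u) [Finite ι] :
    RelationsFG (free ι : SheafOfModules.{u} R) := by
  induction ι using Finite.induction_empty_option with
  | of_equiv e h =>
    have : Mono (freeMap (R := R) e.symm) := by
      have : freeMap (R := R) e.symm ≫ freeMap e = 𝟙 _ := by
        rw [freeMap_comp, e.self_comp_symm, freeMap_id]
      exact mono_of_mono_fac this
    exact h.of_mono (freeMap e.symm)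
  | h_empty =>
    have : Mono (0 : (free PEmpty : SheafOfModules.{u} R) ⟶ unit R) := by
      constructor
      intro P a b _
      have hid : 𝟙 (free PEmpty : SheafOfModules.{u} R) = 0 :=
        Cofan.IsColimit.hom_ext (isColimitFreeCofan (R := R) PEmpty) _ _ nofun
      rw [← Category.comp_id a, ← Category.comp_id b, hid, comp_zero, comp_zero]
    exact hR.of_mono 0
  | @h_option ι _ h =>
    classical
    let φ : (free ι : SheafOfModules.{u} R) ⟶ free (Option ι) := freeMap some
    let ψ : (free (Option ι) : SheafOfModules.{u} R) ⟶ unit R := freeCoord none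
    let π : (free (Option ι) : SheafOfModules.{u} R) ⟶ free ι :=
      Cofan.IsColimit.desc (isColimitFreeCofan (Option ι)) fun o => o.elim 0 fun i => ιFree i
    have hπ (o : Option ι) : ιFree o ≫ π = o.elim 0 fun i => ιFree i :=
      Cofan.IsColimit.fac (isColimitFreeCofan (R := R) (Option ι)) _ o
    have hφπ : φ ≫ π = 𝟙 _ := by
      refine Cofan.IsColimit.hom_ext (isColimitFreeCofan (R := R) ι) _ _ fun i => ?_
      change ιFree i ≫ freeMap some ≫ π = ιFree i ≫ 𝟙 _
      rw [ιFree_freeMap_assoc, hπ, Category.comp_id, Option.elim_some]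
    have hid : 𝟙 (free (Option ι) : SheafOfModules.{u} R) = π ≫ φ + ψ ≫ ιFree none := by
      refine Cofan.IsColimit.hom_ext (isColimitFreeCofan (R := R) (Option ι)) _ _ fun o => ?_
      change ιFree o ≫ 𝟙 _ = ιFree o ≫ (π ≫ φ + ψ ≫ ιFree none)
      rw [Category.comp_id, Preadditive.comp_add, ← Category.assoc, hπ, ← Category.assoc,
        ιFree_freeCoord]
      cases o with
      | none => simp
      | some i => simp [φ]
    -- The split sequence `𝒪^ι ⟶ 𝒪^(Option ι) ⟶ 𝒪` reduces the step to `𝒪^ι` and `𝒪`.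
    refine RelationsFG.of_exact (φ := φ) (ψ := ψ) (fun W => ?_) (fun W t ht => ?_) h hR
    · refine Function.LeftInverse.injective (g := onSec π W) fun t => ?_
      exact congr(onSec $hφπ W t)
    · refine ⟨onSec π W t, ?_⟩
      refine Eq.trans ?_ congr(onSec $hid W t).symm
      change _ = onSec φ W (onSec π W t) + onSec (ιFree none) W (onSec ψ W t)
      rw [ht, map_zero, add_zero]

lemma locallyFG_kernel {ι : Type u} [Fintype ι] (hM : RelationsFG M) (f : free ι ⟶ M) :
    LocallyFG (kernel f) := by
  rw [← isFiniteType_iff_locallyFG, isFiniteType_kernel_iff_locally]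
  intro x
  obtain ⟨V, g, hxV, κ, _, ρ, h⟩ := hM ⊤ ι _ (fun i => secAt (M.freeHomEquiv f i) ⊤) x trivial
  simp only [res_secAt] at h
  exact ⟨V, hxV, κ, _, ρ, h⟩

end Opens

end SheafOfModules

/-! ### Exactness of global sections on presentations: the coherent case -/

namespace AlgebraicGeometry.LocallyRingedSpace

open SheafOfModules

variable {X : LocallyRingedSpace.{u}}

section

variable {P : ObjectProperty X.Modules} (hP : X.GlobalSectionsExactOn P)
include hP

lemma surjective_of_globalSectionsExactOn {S : ShortComplex X.Modules} (hS : S.ShortExact)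
    (h₁ : P S.X₁) (h₂ : P S.X₂) (h₃ : P S.X₃) :
    Function.Surjective (onSec S.g (⊤ : Opens X.carrier)) := by
  have := (hP S hS h₁ h₂ h₃).epi_g
  exact (ModuleCat.epi_iff_surjective _).mp this

/-- If `Γ(X, -)` is exact on a class containing the terms of `F₁ ⟶ F₂ ⟶ F₃ ⟶ 0` and the two
kernels, then it maps this exact sequence to an exact sequence. -/
lemma rightExact_of_globalSectionsExactOn {S : ShortComplex X.Modules} (hS : S.Exact) [Epi S.g]
    (h₁ : P S.X₁) (h₂ : P S.X₂) (h₃ : P S.X₃) (hf : P (kernel S.f)) (hg : P (kernel S.g)) :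
    Function.Surjective (onSec S.g (⊤ : Opens X.carrier)) ∧
      ∀ y, onSec S.g (⊤ : Opens X.carrier) y = 0 → ∃ x, onSec S.f (⊤ : Opens X.carrier) x = y := by
  have hlift : Epi (kernel.lift S.g S.f S.zero) := S.exact_iff_epi_kernel_lift.mp hS
  constructor
  · refine surjective_of_globalSectionsExactOn hP
      (S := ShortComplex.mk (kernel.ι S.g) S.g (kernel.condition _)) ?_ hg h₂ h₃
    exact ⟨ShortComplex.exact_kernel _⟩
  · intro y hy
    obtain ⟨z, rfl⟩ := exists_onSec_kernel_ι_eq S.g y hy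
    have hw : kernel.ι S.f ≫ kernel.lift S.g S.f S.zero = 0 := by
      rw [← cancel_mono (kernel.ι S.g), Category.assoc, kernel.lift_ι, kernel.condition, zero_comp]
    -- Since the kernel of `S.g` is a subobject of `S.X₂`, the map from `S.X₁` onto it has the same
    -- kernel as `S.f`. This gives a second short exact sequence with terms in the class.
    have hex : (ShortComplex.mk (kernel.ι S.f) (kernel.lift S.g S.f S.zero) hw).Exact := by
      refine ShortComplex.exact_of_f_is_kernel _ (KernelFork.IsLimit.ofι' _ _ fun {A} k hk => ?_)
      refine ⟨kernel.lift S.f k ?_, kernel.lift_ι _ _ _⟩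
      rw [← kernel.lift_ι S.g S.f S.zero, ← Category.assoc, hk, zero_comp]
    obtain ⟨x, rfl⟩ := surjective_of_globalSectionsExactOn hP
      (S := ShortComplex.mk _ _ hw) ⟨hex⟩ hf h₁ hg z
    exact ⟨x, congr(onSec $(kernel.lift_ι S.g S.f S.zero) (⊤ : Opens X.carrier) x).symm⟩

end

variable (X) in
/-- The functor `Γ(X, -)` preserves exactness of finite presentations `𝒪_X^I ⟶ 𝒪_X^J ⟶ F ⟶ 0`. -/
def SectionsExactOnPresentations : Prop :=
  ∀ (S : ShortComplex X.Modules) (I J : Type u) [Finite I] [Finite J] [Nonempty I] [Nonempty J]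
    (_ : S.X₁ ≅ SheafOfModules.free I) (_ : S.X₂ ≅ SheafOfModules.free J), S.Exact → Epi S.g →
    Function.Surjective (onSec S.g (⊤ : Opens X.carrier)) ∧
      ∀ y, onSec S.g (⊤ : Opens X.carrier) y = 0 → ∃ x, onSec S.f (⊤ : Opens X.carrier) x = y

lemma isCoherent_of_iso {F G : X.Modules} (e : F ≅ G) (hF : X.isCoherent F) : X.isCoherent G := by
  rw [isCoherent_iff] at hF ⊢
  exact ⟨hF.1.of_epi e.hom, hF.2.of_mono e.inv⟩

/-- Finite free modules are coherent together with `𝒪_X`. The kernel of `S.f` is locally generated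
because relations in `S.X₂` are; the kernel of `S.g` is a quotient of `S.X₁` inside `S.X₂`; and
`S.X₃` is a cokernel. -/
lemma sectionsExactOnPresentations_of_isCoherent
    (hX : X.isCoherent (SheafOfModules.unit X.ringCatSheaf))
    (h : X.GlobalSectionsExactOn X.isCoherent) : X.SectionsExactOnPresentations := by
  rw [isCoherent_iff] at hX
  have hfree (I : Type u) [Finite I] : X.isCoherent (SheafOfModules.free I) := by
    have := Fintype.ofFinite I
    rw [isCoherent_iff]
    exact ⟨locallyFG_free I, relationsFG_free hX.2 I⟩
  intro S I J _ _ _ _ e₁ e₂ hS _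
  have h₁ : X.isCoherent S.X₁ := isCoherent_of_iso e₁.symm (hfree I)
  have h₂ : X.isCoherent S.X₂ := isCoherent_of_iso e₂.symm (hfree J)
  rw [isCoherent_iff] at h₁ h₂
  have hlift : Epi (kernel.lift S.g S.f S.zero) := S.exact_iff_epi_kernel_lift.mp hS
  refine rightExact_of_globalSectionsExactOn h hS ?_ ?_ ?_ ?_ ?_ <;> rw [isCoherent_iff]
  · exact h₁
  · exact h₂
  · exact ⟨h₂.1.of_epi S.g, RelationsFG.of_epi hS h₁.1 h₂.2⟩
  · refine ⟨?_, h₁.2.of_mono (kernel.ι S.f)⟩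
    have := Fintype.ofFinite I
    have hk := locallyFG_kernel h₂.2 (e₁.inv ≫ S.f)
    exact hk.of_epi (kernelIsIsoComp e₁.inv S.f).hom
  · exact ⟨h₁.1.of_epi (kernel.lift S.g S.f S.zero), h₂.2.of_mono (kernel.ι S.g)⟩

end AlgebraicGeometry.LocallyRingedSpace

/-! ### Flatness, Noetherian rings and extending presentations to the left -/

/-- If a finite family generates the relations between the rows of a matrix over `A`, then it
generates the relations over any flat `A`-algebra. -/
lemma Module.Flat.exists_eq_sum_of_relations {A B : Type*} [CommRing A] [CommRing B] [Algebra A B]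
    [Module.Flat A B] {I J K : Type*} [Fintype I] [Fintype J] [Fintype K] (a : I → J → A)
    (ρ : K → I → A)
    (hρ : ∀ c : I → A, (∀ j, ∑ i, c i * a i j = 0) → ∃ d : K → A, ∀ i, c i = ∑ k, d k * ρ k i)
    (y : I → B) (hy : ∀ j, ∑ i, y i * algebraMap A B (a i j) = 0) :
    ∃ d : K → B, ∀ i, y i = ∑ k, d k * algebraMap A B (ρ k i) := by
  classical
  let x : (I → A) →ₗ[A] B := Fintype.linearCombination A y
  let f : (J → A) →ₗ[A] (I → A) := Fintype.linearCombination A fun j i => a i j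
  have hf (j : J) : f (Pi.single j 1) = fun i => a i j := by
    simp [f, Fintype.linearCombination_apply_single]
  have hx (i : I) : x (Pi.single i 1) = y i := by
    simp [x, Fintype.linearCombination_apply_single]
  have hxf : x ∘ₗ f = 0 := by
    refine LinearMap.pi_ext' fun j => LinearMap.ext_ring ?_
    simp only [LinearMap.comp_apply, LinearMap.single_apply, hf, LinearMap.zero_apply]
    rw [Fintype.linearCombination_apply, ← hy j]
    exact Finset.sum_congr rfl fun i _ => by rw [Algebra.smul_def, mul_comm]
  -- Equational criterion of flatness: the relation `y`, viewed as the map `x`, factors as `β ∘ α`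
  -- through `A^n` with `α ∘ f = 0`. Each coordinate of `α` is then a relation over `A`, to which
  -- `hρ` applies.
  obtain ⟨n, α, β, hαβ, hα⟩ := Module.Flat.exists_factorization_of_comp_eq_zero_of_free hxf
  have hc (l : Fin n) : ∃ d : K → A, ∀ i, α (Pi.single i 1) l = ∑ k, d k * ρ k i := by
    refine hρ _ fun j => ?_
    have h := congr($hα (Pi.single j 1) l)
    simp only [LinearMap.comp_apply, hf, LinearMap.zero_apply, Finsupp.coe_zero,
      Pi.zero_apply] at h
    rw [pi_eq_sum_univ' (fun i => a i j), map_sum, Finsupp.finsetSum_apply] at h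
    rw [← h]
    exact Finset.sum_congr rfl fun i _ => by
      rw [map_smul, Finsupp.smul_apply, smul_eq_mul, mul_comm]
  choose d hd using hc
  refine ⟨fun k => ∑ l, algebraMap A B (d l k) * β (Finsupp.single l 1), fun i => ?_⟩
  rw [← hx, hαβ, LinearMap.comp_apply, ← Finsupp.univ_sum_single (α (Pi.single i 1)), map_sum]
  simp only [hd, Finset.sum_mul]
  rw [Finset.sum_comm]
  refine Finset.sum_congr rfl fun l _ => ?_
  rw [← mul_one (∑ k, d l k * ρ k i), ← smul_eq_mul, ← Finsupp.smul_single, map_smul,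
    Finset.sum_smul]
  refine Finset.sum_congr rfl fun k _ => ?_
  rw [Algebra.smul_def, map_mul]
  ring

/-- Finitely many relations generate the relations between the rows of a matrix over a noetherian
ring. -/
lemma IsNoetherianRing.exists_generating_relations {A : Type u} [CommRing A] [IsNoetherianRing A]
    {I J : Type u} [Fintype I] [Fintype J] (a : I → J → A) :
    ∃ (K : Type u) (_ : Fintype K) (_ : Nonempty K) (ρ : K → I → A),
      (∀ k j, ∑ i, ρ k i * a i j = 0) ∧ ∀ c : I → A, (∀ j, ∑ i, c i * a i j = 0) →
        ∃ d : K → A, ∀ i, c i = ∑ k, d k * ρ k i := by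
  obtain ⟨n, s, hs⟩ := Submodule.fg_iff_exists_fin_generating_family.mp
    (IsNoetherian.noetherian (LinearMap.ker (Fintype.linearCombination A a)))
  have hmem (c : I → A) :
      (∀ j, ∑ i, c i * a i j = 0) ↔ ∃ d : Fin n → A, ∑ k, d k • s k = c := by
    rw [← Submodule.mem_span_range_iff_exists_fun, hs, LinearMap.mem_ker,
      Fintype.linearCombination_apply, funext_iff]
    simp
  -- The additional index carries the zero relation and makes the index type nonempty, as
  -- `isACoherent` demands.
  refine ⟨Option (ULift.{u} (Fin n)), inferInstance, inferInstance,
    fun k => k.elim 0 fun l => s l.down, fun k j => ?_, fun c hc => ?_⟩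
  · cases k with
    | none => simp
    | some l =>
      classical
      exact (hmem (s l.down)).mpr ⟨Pi.single l.down 1, by simp [Pi.single_apply]⟩ j
  · obtain ⟨d, rfl⟩ := (hmem c).mp hc
    refine ⟨fun k => k.elim 0 fun l => d l.down, fun i => ?_⟩
    rw [Fintype.sum_option, Finset.sum_apply,
      ← (Equiv.ulift.{u}.symm : Fin n ≃ ULift.{u} (Fin n)).sum_comp]
    simp

namespace SheafOfModules

section

variable {C : Type u₁} [Category.{v₁} C] {J : GrothendieckTopology C} {R : Sheaf J RingCat.{u}}
  [HasSheafify J AddCommGrpCat.{u}] [J.WEqualsLocallyBijective AddCommGrpCat.{u}]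
  {ι : Type u} [Fintype ι]

lemma freeMk_zero {W : C} : freeMk (R := R) (ι := ι) (W := W) (fun _ => 0) = 0 :=
  Finset.sum_eq_zero fun _ _ => by rw [map_zero, map_zero]

end

variable {C : Type u₁} [Category.{v₁} C] {J : GrothendieckTopology C} {R : Sheaf J RingCat.{u}}
  [HasSheafify J AddCommGrpCat.{u}] [J.WEqualsLocallyBijective AddCommGrpCat.{u}]
  {M : SheafOfModules.{u} R} {ι κ : Type u} [Fintype ι] [Fintype κ] {T : C} (hT : IsTerminal T)
include hT

lemma exact_of_genRelations {f : free ι ⟶ M} {h : (free κ : SheafOfModules.{u} R) ⟶ free ι}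
    {ρ : κ → ι → RSec R T} (hρ : GenRelations M (fun i => secAt (M.freeHomEquiv f i) T) ρ)
    (hh : ∀ k, secAt ((free ι).freeHomEquiv h k) T = freeMk (ρ k)) :
    ∃ w : h ≫ f = 0, (ShortComplex.mk h f w).Exact := by
  have key {W : C} (c : κ → RSec R W) :
      onSec h W (freeMk c) = freeMk fun i => ∑ k, c k * resR R (hT.from W) (ρ k i) := by
    rw [onSec_freeMk, ← freeMk_sum]
    refine Finset.sum_congr rfl fun i _ => ?_
    rw [← res_secAt _ (hT.from W), hh, res_freeMk]
  have w : h ≫ f = 0 := by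
    refine hom_ext_sec fun W t => ?_
    obtain ⟨c, rfl⟩ := freeMk_surjective t
    rw [onSec_comp, key, onSec_freeMk, onSec_zero]
    simp only [Finset.sum_smul, mul_smul]
    rw [Finset.sum_comm]
    refine Finset.sum_eq_zero fun k _ => ?_
    rw [← Finset.smul_sum, ← smul_zero (c k), ← map_zero (M.res (hT.from W)), ← hρ.1 k, map_sum]
    simp only [res_smul, res_secAt]
  refine ⟨w, exact_of_locally fun W t ht => ?_⟩
  obtain ⟨y, rfl⟩ := freeMk_surjective t
  obtain ⟨S, hS, H⟩ := hρ.2 W (hT.from W) y (by simpa only [res_secAt, ← onSec_freeMk] using ht)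
  refine ⟨S, hS, fun V g hg => ?_⟩
  obtain ⟨c, hc⟩ := H V g hg
  refine ⟨freeMk c, (key c).trans (Eq.trans ?_ (res_freeMk g y).symm)⟩
  congr 1
  funext i
  rw [hc, hT.hom_ext (g ≫ hT.from W) (hT.from V)]

end SheafOfModules

namespace AlgebraicGeometry.LocallyRingedSpace

open SheafOfModules TopCat.Presheaf

variable {X : LocallyRingedSpace.{u}}

/-- The germ map is the localization of `Γ(X, 𝒪_X)` at a prime followed by the stalk map of
`X.toΓSpec`, and both are flat. -/
lemma flat_Γgerm (hflat : IsFlat X.toΓSpec) (x : X) : (X.presheaf.Γgerm x).hom.Flat := by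
  have h : StructureSheaf.toStalk (Γ.obj (op X)) (X.toΓSpecFun x) ≫
      X.toΓSpec.stalkMap x = X.presheaf.Γgerm x := X.toStalk_stalkMap_toΓSpec x
  have h' : (X.presheaf.Γgerm x).hom = (X.toΓSpec.stalkMap x).hom.comp
    (StructureSheaf.toStalk (Γ.obj (op X)) (X.toΓSpecFun x)).hom := congr(($h).hom).symm
  have hA : Module.Flat (Γ.obj (op X))
      ((Spec.structureSheaf (Γ.obj (op X))).presheaf.stalk (X.toΓSpecFun x)) :=
    IsLocalization.flat _ (X.toΓSpecFun x).asIdeal.primeCompl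
  have h₁ : (StructureSheaf.toStalk (Γ.obj (op X)) (X.toΓSpecFun x)).hom.Flat := hA
  exact h' ▸ RingHom.Flat.comp h₁ (hflat x)

section Relations

variable {I J K : Type u} [Fintype I] [Fintype J] [Fintype K]
  {a : I → J → Γ.obj (op X)} {ρ : K → I → Γ.obj (op X)}

/-- Over an open subset, relations between the rows of a matrix of global functions are locally
combinations of the global relations, if `X ⟶ Spec Γ(X, 𝒪_X)` is flat. -/
lemma exists_germ_relations (hflat : IsFlat X.toΓSpec)
    (hρ : ∀ c : I → Γ.obj (op X), (∀ j, ∑ i, c i * a i j = 0) →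
      ∃ d : K → Γ.obj (op X), ∀ i, c i = ∑ k, d k * ρ k i)
    {W : Opens X.carrier} (y : I → X.presheaf.obj (op W))
    (hy : ∀ j, ∑ i, y i * X.presheaf.map (homOfLE le_top).op (a i j) = 0) {x : X.carrier}
    (hx : x ∈ W) : ∃ (V : Opens X.carrier) (g : V ⟶ W), x ∈ V ∧
      ∃ d : K → X.presheaf.obj (op V), ∀ i, X.presheaf.map g.op (y i) =
        ∑ k, d k * X.presheaf.map (homOfLE le_top).op (ρ k i) := by
  let : Algebra (Γ.obj (op X)) (X.presheaf.stalk x) := (X.presheaf.Γgerm x).hom.toAlgebra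
  have : Module.Flat (Γ.obj (op X)) (X.presheaf.stalk x) := flat_Γgerm hflat x
  have hgerm {V : Opens X.carrier} (hV : x ∈ V) (b : Γ.obj (op X)) :
      X.presheaf.germ V x hV (X.presheaf.map (homOfLE le_top).op b) =
        algebraMap (Γ.obj (op X)) (X.presheaf.stalk x) b :=
    germ_res_apply X.presheaf (homOfLE le_top) x hV b
  obtain ⟨d, hd⟩ := Module.Flat.exists_eq_sum_of_relations a ρ hρ
    (fun i => X.presheaf.germ W x hx (y i)) fun j => by
      simpa only [map_sum, map_mul, hgerm, map_zero] using
        congr(X.presheaf.germ W x hx $(hy j))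
  -- The coefficients found in the stalk are finitely many, so they are represented over a common
  -- neighbourhood; after a second shrinking the finitely many equations hold there as well.
  obtain ⟨V, g, hxV, hd'⟩ : ∃ (V : Opens X.carrier) (g : V ⟶ W), x ∈ V ∧ ∀ k,
      ∀ h : x ∈ V, ∃ t : X.presheaf.obj (op V), X.presheaf.germ V x h t = d k := by
    refine exists_common_refinement (p := fun k V g => ∀ h : x ∈ V,
      ∃ t : X.presheaf.obj (op V), X.presheaf.germ V x h t = d k) hx ?_ ?_
    · intro k V V' g h hk hx'
      obtain ⟨t, ht⟩ := hk (h.le hx')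
      exact ⟨X.presheaf.map h.op t, (germ_res_apply _ h x hx' t).trans ht⟩
    · intro k
      obtain ⟨V, hVW, hxV, t, ht⟩ := exists_le_germ_eq X.presheaf (d k) hx
      exact ⟨V, homOfLE hVW, hxV, fun _ => ⟨t, ht⟩⟩
  choose t ht using fun k => hd' k hxV
  obtain ⟨V', g', hxV', h'⟩ : ∃ (V' : Opens X.carrier) (g' : V' ⟶ V), x ∈ V' ∧ ∀ i,
      X.presheaf.map g'.op (X.presheaf.map g.op (y i)) = X.presheaf.map g'.op
        (∑ k, t k * X.presheaf.map (homOfLE le_top).op (ρ k i)) := by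
    refine exists_common_refinement (p := fun i V' g' =>
      X.presheaf.map g'.op (X.presheaf.map g.op (y i)) = X.presheaf.map g'.op
        (∑ k, t k * X.presheaf.map (homOfLE le_top).op (ρ k i))) hxV ?_ ?_
    · intro i V V' g h hk
      rw [op_comp, X.presheaf.map_comp, CommRingCat.comp_apply, hk, CommRingCat.comp_apply]
    · intro i
      obtain ⟨V', hxV', g₁, g₂, h⟩ := germ_eq X.presheaf x hxV hxV (X.presheaf.map g.op (y i))
        (∑ k, t k * X.presheaf.map (homOfLE le_top).op (ρ k i)) (by
          rw [germ_res_apply, hd i, map_sum]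
          simp only [map_mul, hgerm, ht])
      obtain rfl : g₁ = g₂ := Subsingleton.elim _ _
      exact ⟨V', g₁, hxV', h⟩
  refine ⟨V', g' ≫ g, hxV', fun k => X.presheaf.map g'.op (t k), fun i => ?_⟩
  rw [op_comp, X.presheaf.map_comp, CommRingCat.comp_apply, h', map_sum]
  refine Finset.sum_congr rfl fun k _ => ?_
  rw [map_mul]
  congr 1
  exact congr(($(X.presheaf.map_comp (homOfLE le_top).op g'.op)).hom (ρ k i)).symm

end Relations

/-- Over a noetherian ring of global functions, a presentation matrix extends to the left. -/
lemma exists_exact_free [IsNoetherianRing (Γ.obj (op X))] (hflat : IsFlat X.toΓSpec)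
    {I J : Type u} [Finite I] [Finite J]
    (f : (SheafOfModules.free I : X.Modules) ⟶ SheafOfModules.free J) :
    ∃ (K : Type u) (_ : Finite K) (_ : Nonempty K)
      (h : (SheafOfModules.free K : X.Modules) ⟶ SheafOfModules.free I) (w : h ≫ f = 0),
      (ShortComplex.mk h f w).Exact := by
  have := Fintype.ofFinite I
  have := Fintype.ofFinite J
  obtain ⟨a, ha⟩ : ∃ a : I → J → Γ.obj (op X), ∀ i,
      secAt ((SheafOfModules.free J : X.Modules).freeHomEquiv f i) (⊤ : Opens X.carrier) =
        freeMk (R := X.ringCatSheaf) (a i) :=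
    ⟨_, fun i => (freeMk_surjective _).choose_spec.symm⟩
  obtain ⟨K, _, _, ρ, hρ, hρ'⟩ := IsNoetherianRing.exists_generating_relations a
  let h : (SheafOfModules.free K : X.Modules) ⟶ SheafOfModules.free I :=
    (SheafOfModules.free I : X.Modules).freeHomEquiv.symm fun k =>
      mkSection (isTerminalTop : IsTerminal (⊤ : Opens X.carrier)) _
        (freeMk (R := X.ringCatSheaf) (ρ k))
  have hh (k) : secAt ((SheafOfModules.free I : X.Modules).freeHomEquiv h k)
      (⊤ : Opens X.carrier) = freeMk (R := X.ringCatSheaf) (ρ k) := by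
    rw [Equiv.apply_symm_apply, secAt_mkSection]
    exact res_id _ _ _
  refine ⟨K, inferInstance, inferInstance, h,
    exact_of_genRelations (isTerminalTop : IsTerminal (⊤ : Opens X.carrier)) (ρ := ρ) ?_ hh⟩
  simp only [ha]
  refine (genRelations_iff_forall_mem _ _ _).mpr ⟨fun k => ?_, fun W g y hy x hx => ?_⟩
  · refine (freeMk_sum (R := X.ringCatSheaf) (ρ k) a).trans ?_
    exact (congrArg _ (funext (hρ k))).trans freeMk_zero
  · have hy' : ∑ i, y i • freeMk (R := X.ringCatSheaf) (fun j => resR X.ringCatSheaf g (a i j)) =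
        0 := (Finset.sum_congr rfl fun i _ => congrArg (y i • ·)
          (res_freeMk (R := X.ringCatSheaf) g (a i)).symm).trans hy
    obtain ⟨V, g', hxV, d, hd⟩ := exists_germ_relations (a := a) hflat hρ' y
      (fun j => congrFun (freeMk_injective (((freeMk_sum y _).symm.trans hy').trans
        freeMk_zero.symm)) j) hx
    exact ⟨V, g', ⟨d, hd⟩, hxV⟩

/-- The zero map from `𝒪_X^I` serves as the relations, because an empty index type is not allowed.
-/
lemma isACoherent_free (I : Type u) [Finite I] [Nonempty I] :
    X.isACoherent (SheafOfModules.free I) :=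
  ⟨I, I, inferInstance, inferInstance, inferInstance, inferInstance, 0, 𝟙 _, zero_comp,
    (ShortComplex.exact_iff_mono _ rfl).mpr inferInstance, inferInstance⟩

lemma isACoherent_of_iso {F G : X.Modules} (e : F ≅ G) (hF : X.isACoherent F) :
    X.isACoherent G := by
  obtain ⟨I, J, _, _, _, _, f, g, w, h, _⟩ := hF
  refine ⟨I, J, inferInstance, inferInstance, inferInstance, inferInstance, f, g ≫ e.hom,
    by rw [reassoc_of% w, zero_comp], ?_, inferInstance⟩
  exact ShortComplex.exact_of_iso (S₁ := ShortComplex.mk f g w)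
    (ShortComplex.isoMk (Iso.refl _) (Iso.refl _) e) h

/-- In an exact sequence `𝒪_X^I ⟶ 𝒪_X^J ⟶ G ⟶ F`, the kernel of `G ⟶ F` is `A`-coherent. -/
lemma isACoherent_kernel {I J : Type u} [Finite I] [Finite J] [Nonempty I] [Nonempty J]
    {F G : X.Modules} {f : (SheafOfModules.free I : X.Modules) ⟶ SheafOfModules.free J}
    {g : SheafOfModules.free J ⟶ G} {p : G ⟶ F} {w : f ≫ g = 0} {w' : g ≫ p = 0}
    (h : (ShortComplex.mk f g w).Exact) (h' : (ShortComplex.mk g p w').Exact) :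
    X.isACoherent (kernel p) := by
  have hepi : Epi (kernel.lift p g w') := (ShortComplex.exact_iff_epi_kernel_lift _).mp h'
  have hw : f ≫ kernel.lift p g w' = 0 := by
    rw [← cancel_mono (kernel.ι p), Category.assoc, kernel.lift_ι, w, zero_comp]
  refine ⟨I, J, inferInstance, inferInstance, inferInstance, inferInstance, f,
    kernel.lift p g w', hw, ?_, hepi⟩
  let φ : ShortComplex.mk f (kernel.lift p g w') hw ⟶ ShortComplex.mk f g w :=
    { τ₁ := 𝟙 _, τ₂ := 𝟙 _, τ₃ := kernel.ι p }
  have : Epi φ.τ₁ := inferInstanceAs (Epi (𝟙 _))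
  have : IsIso φ.τ₂ := inferInstanceAs (IsIso (𝟙 _))
  have : Mono φ.τ₃ := inferInstanceAs (Mono (kernel.ι p))
  exact (ShortComplex.exact_iff_of_epi_of_isIso_of_mono φ).mpr h

/-- Extend the presentation two steps to the left, to `𝒪^L ⟶ 𝒪^K ⟶ 𝒪^I ⟶ 𝒪^J`. The maps `l` and `k`
then present the kernels of `S.f` and `S.g` respectively. -/
lemma sectionsExactOnPresentations_of_isNoetherianRing [IsNoetherianRing (Γ.obj (op X))]
    (hflat : IsFlat X.toΓSpec) (h : X.GlobalSectionsExactOn X.isACoherent) :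
    X.SectionsExactOnPresentations := by
  intro S I J _ _ _ _ e₁ e₂ hS _
  obtain ⟨K, _, _, k, wk, hk⟩ := exists_exact_free hflat (e₁.inv ≫ S.f ≫ e₂.hom)
  obtain ⟨L, _, _, l, wl, hl⟩ := exists_exact_free hflat k
  have wk' : k ≫ e₁.inv ≫ S.f = 0 := by
    rw [← cancel_mono e₂.hom, Category.assoc, Category.assoc, wk, zero_comp]
  have hk' : (ShortComplex.mk k (e₁.inv ≫ S.f) wk').Exact :=
    ShortComplex.exact_of_iso (S₁ := ShortComplex.mk _ _ wk)
      (ShortComplex.isoMk (Iso.refl _) (Iso.refl _) e₂.symm) hk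
  have hS' : (ShortComplex.mk (e₁.inv ≫ S.f) S.g (by
      rw [Category.assoc, S.zero, comp_zero])).Exact :=
    ShortComplex.exact_of_iso (ShortComplex.isoMk e₁ (Iso.refl _) (Iso.refl _)) hS
  refine rightExact_of_globalSectionsExactOn h hS
    (isACoherent_of_iso e₁.symm (isACoherent_free I))
    (isACoherent_of_iso e₂.symm (isACoherent_free J)) ?_ ?_ (isACoherent_kernel hk' hS')
  · refine ⟨I, J, inferInstance, inferInstance, inferInstance, inferInstance,
      e₁.inv ≫ S.f ≫ e₂.hom, e₂.inv ≫ S.g, by simp, ?_, inferInstance⟩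
    exact ShortComplex.exact_of_iso (ShortComplex.isoMk e₁ e₂ (Iso.refl _)) hS
  · exact isACoherent_of_iso (kernelIsIsoComp e₁.inv S.f) (isACoherent_kernel hl hk')

end AlgebraicGeometry.LocallyRingedSpace

/-! ### Change of generators -/

namespace SheafOfModules

variable {X : Type u} [TopologicalSpace X] {R : Sheaf (Opens.grothendieckTopology X) RingCat.{u}}
  {M : SheafOfModules.{u} R}

lemma Spans.of_locally {Z : Opens X} {ι : Type u} [Fintype ι] {s : ι → M.Sec Z}
    (h : ∀ x ∈ Z, ∃ (V : Opens X) (g : V ⟶ Z), x ∈ V ∧ ∃ (κ : Type u) (_ : Fintype κ)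
      (s' : κ → M.Sec V), Spans M s' ∧ ∀ k, ∃ b : ι → RSec R V,
        s' k = ∑ i, b i • M.res g (s i)) : Spans M s := by
  refine (spans_iff_forall_mem M s).mpr fun W f t x hx => ?_
  obtain ⟨V, g, hxV, κ, _, s', hs', hb⟩ := h x (f.le hx)
  choose b hb using hb
  obtain ⟨V', g', ⟨c, hc⟩, hxV'⟩ := (spans_iff_forall_mem M s').mp hs' (W ⊓ V)
    (homOfLE inf_le_right) (M.res (homOfLE inf_le_left) t) x ⟨hx, hxV⟩
  refine ⟨V', g' ≫ homOfLE inf_le_left, ⟨fun i => ∑ k, c k *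
    resR R (g' ≫ homOfLE inf_le_right) (b k i), ?_⟩, hxV'⟩
  rw [sum_mul_smul, ← M.res_res, ← hc]
  refine Finset.sum_congr rfl fun k _ => ?_
  rw [hb, map_sum]
  simp only [res_smul, res_res]
  rfl

/-- Relations between one spanning family give relations between another one. -/
lemma GenRelations.of_change {V : Opens X} {ι α β : Type u} [Fintype ι] [Fintype α] [Fintype β]
    [DecidableEq ι] {s : ι → M.Sec V} {t : α → M.Sec V} {σ : β → α → RSec R V}
    (hσ : GenRelations M t σ) (c : ι → α → RSec R V) (b : α → ι → RSec R V)
    (hc : ∀ i, ∑ a, c i a • t a = s i) (hb : ∀ a, ∑ i, b a i • s i = t a) :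
    GenRelations M s (Sum.elim (fun i j => (if i = j then 1 else 0) - ∑ a, c i a * b a j)
      (fun k j => ∑ a, σ k a * b a j)) := by
  refine ⟨?_, fun W f r hr => ?_⟩
  · rintro (i | k)
    · simp only [Sum.elim_inl, sub_smul, Finset.sum_sub_distrib, sum_mul_smul, hb, hc]
      simp
    · simp only [Sum.elim_inr, sum_mul_smul, hb, hσ.1]
  · obtain ⟨S, hS, h⟩ := hσ.2 W f (fun a => ∑ i, r i * resR R f (c i a)) (by
      rw [sum_mul_smul, ← hr]
      refine Finset.sum_congr rfl fun i _ => ?_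
      rw [← hc, map_sum]
      simp only [res_smul])
    refine ⟨S, hS, fun V' g hg => ?_⟩
    obtain ⟨d, hd⟩ := h V' g hg
    -- In matrix form `r = r(1 - cb) + (rc)b`, and `rc` is a relation between the `t a`, hence equal
    -- to `dσ`.
    refine ⟨Sum.elim (fun i => resR R g (r i)) d, fun j => ?_⟩
    have hd' : ∑ k, d k * ∑ a, resR R (g ≫ f) (σ k a) * resR R (g ≫ f) (b a j) =
        ∑ i, resR R g (r i) * ∑ a, resR R (g ≫ f) (c i a) * resR R (g ≫ f) (b a j) := by
      simp only [Finset.mul_sum, ← mul_assoc]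
      refine Finset.sum_comm.trans (Eq.trans ?_ Finset.sum_comm)
      refine Finset.sum_congr rfl fun a _ => ?_
      rw [← Finset.sum_mul, ← Finset.sum_mul, ← hd, map_sum]
      simp only [map_mul, resR_resR]
    simp only [Fintype.sum_sum_type, Sum.elim_inl, Sum.elim_inr, map_sub, map_sum, map_mul, hd',
      mul_sub, Finset.sum_sub_distrib, sub_add_cancel]
    rw [Finset.sum_eq_single j]
    · simp
    · intro i _ hi
      rw [if_neg hi, map_zero, mul_zero]
    · exact fun h => (h (Finset.mem_univ _)).elim

/-- The relations between a spanning family are locally finitely generated if there is one such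
spanning family locally. -/
lemma exists_genRelations_of_locallyFP (hM : LocallyFP M) {Z : Opens X} {ι : Type u} [Fintype ι]
    {s : ι → M.Sec Z} (hs : Spans M s) {x : X} (hx : x ∈ Z) :
    ∃ (V : Opens X) (g : V ⟶ Z), x ∈ V ∧ ∃ (κ : Type u) (_ : Fintype κ) (ρ : κ → ι → RSec R V),
      GenRelations M (fun i => M.res g (s i)) ρ := by
  classical
  obtain ⟨Z', hxZ', α, _, t, β, _, σ, ht, hσ⟩ := hM x
  have hx' : x ∈ Z ⊓ Z' := ⟨hx, hxZ'⟩
  -- Near `x` each of the two spanning families is a combination of the other.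
  obtain ⟨V, g, hxV, h⟩ := exists_common_refinement (U := Z ⊓ Z') (ι := ι ⊕ α) hx'
    (p := fun k V g => match k with
      | .inl i => ∃ c : α → RSec R V, ∑ a, c a • M.res (g ≫ homOfLE inf_le_right) (t a) =
        M.res (g ≫ homOfLE inf_le_left) (s i)
      | .inr a => ∃ b : ι → RSec R V, ∑ i, b i • M.res (g ≫ homOfLE inf_le_left) (s i) =
        M.res (g ≫ homOfLE inf_le_right) (t a)) (by
    rintro (i | a) V V' g h ⟨c, hc⟩
    all_goals
      refine ⟨fun i => resR R h (c i), ?_⟩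
      have h' := congr(M.res h $hc)
      rw [map_sum] at h'
      simpa only [res_smul, res_res, Category.assoc] using h') (by
    rintro (i | a)
    · obtain ⟨V, g, ⟨c, hc⟩, hxV⟩ := (spans_iff_forall_mem M t).mp ht (Z ⊓ Z')
        (homOfLE inf_le_right) (M.res (homOfLE inf_le_left) (s i)) x hx'
      exact ⟨V, g, hxV, c, hc.trans (M.res_res _ _ _)⟩
    · obtain ⟨V, g, ⟨c, hc⟩, hxV⟩ := (spans_iff_forall_mem M s).mp hs (Z ⊓ Z')
        (homOfLE inf_le_left) (M.res (homOfLE inf_le_right) (t a)) x hx'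
      exact ⟨V, g, hxV, c, hc.trans (M.res_res _ _ _)⟩)
  choose c hc using fun i => h (.inl i)
  choose b hb using fun a => h (.inr a)
  exact ⟨V, g ≫ homOfLE inf_le_left, hxV, _, inferInstance, _,
    (hσ.restrict (g ≫ homOfLE inf_le_right)).of_change c b hc hb⟩

end SheafOfModules

/-! ### Localization of sections on the spectrum of a ring -/

namespace AlgebraicGeometry

open SheafOfModules _root_.PrimeSpectrum

variable {A : CommRingCat.{u}}

/-- The structure sheaf of `Spec A` as a sheaf of rings. -/
abbrev specRingSheaf (A : CommRingCat.{u}) : Sheaf (Opens.grothendieckTopology (PrimeSpectrum A))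
    RingCat.{u} :=
  (Spec.locallyRingedSpaceObj A).ringCatSheaf

/-- The sections of the structure sheaf of `Spec A` given by elements of `A`. -/
def specSec (A : CommRingCat.{u}) (W : Opens (PrimeSpectrum A)) : A →+* RSec (specRingSheaf A) W :=
  (resR (specRingSheaf A) (homOfLE le_top : W ⟶ ⊤)).comp (Scheme.ΓSpecIso A).inv.hom

lemma resR_specSec {V W : Opens (PrimeSpectrum A)} (g : V ⟶ W) (a : A) :
    resR (specRingSheaf A) g (specSec A W a) = specSec A V a :=
  resR_resR _ _ _

lemma exists_mem_basicOpen {x : PrimeSpectrum A} {U : Opens (PrimeSpectrum A)} (hx : x ∈ U) :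
    ∃ a : A, x ∈ basicOpen a ∧ basicOpen a ≤ U := by
  obtain ⟨_, ⟨_, ⟨a, rfl⟩, rfl⟩, hxa, hU⟩ :=
    isBasis_basic_opens.exists_subset_of_mem_open hx U.2
  exact ⟨a, hxa, hU⟩

/-- The sections of a sheaf of modules over the principal open subsets of `Spec A` are, as far as
single elements are concerned, the localizations of its global sections. -/
structure Localizing (M : SheafOfModules.{u} (specRingSheaf A)) : Prop where
  lift (a : A) (s : M.Sec (basicOpen a)) : ∃ (n : ℕ) (t : M.Sec (⊤ : Opens (PrimeSpectrum A))),
    M.res (homOfLE le_top) t = specSec A (basicOpen a) (a ^ n) • s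
  zero (a : A) (t : M.Sec (⊤ : Opens (PrimeSpectrum A)))
    (ht : M.res (homOfLE le_top : basicOpen a ⟶ ⊤) t = 0) : ∃ n : ℕ, specSec A ⊤ (a ^ n) • t = 0

lemma localizing_of_isQuasicoherent (M : SheafOfModules.{u} (specRingSheaf A))
    [M.IsQuasicoherent] : Localizing M := by
  let M' : (Spec A).Modules := M
  have : M'.IsQuasicoherent := ‹_›
  have h : IsLocalizing (modulesSpecToSheaf.obj M') :=
    (isIso_fromTildeΓ_iff_isLocalizing M').mp inferInstance
  refine ⟨fun a s => ?_, fun a t ht => ?_⟩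
  · have := h a
    obtain ⟨⟨t, ⟨_, n, rfl⟩⟩, hn⟩ := IsLocalizedModule.surj (.powers a)
      ((modulesSpecToSheaf.obj M').obj.map (Opens.leTop (X := Spec A) (basicOpen a)).op).hom s
    exact ⟨n, t, hn.symm⟩
  · have := h a
    obtain ⟨⟨_, n, rfl⟩, hn⟩ := (IsLocalizedModule.eq_zero_iff (.powers a)
      ((modulesSpecToSheaf.obj M').obj.map (Opens.leTop (X := Spec A) (basicOpen a)).op).hom).mp ht
    exact ⟨n, hn⟩

lemma Localizing.of_locallyFP {M : SheafOfModules.{u} (specRingSheaf A)} (hM : LocallyFP M) :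
    Localizing M := by
  have := (isFinitePresentation_iff_locallyFP M).mpr hM
  exact localizing_of_isQuasicoherent M

lemma localizing_free (I : Type u) [Finite I] :
    Localizing (free I : SheafOfModules.{u} (specRingSheaf A)) := by
  have := Fintype.ofFinite I
  refine .of_locallyFP fun x => ⟨⊤, trivial, I, inferInstance, _, PEmpty, inferInstance,
    PEmpty.elim, (epi_iff_spans (𝟙 (free I)) isTerminalTop).mp inferInstance, ?_⟩
  refine ⟨fun k => k.elim, fun W g r hr => ⟨⊤, (Opens.grothendieckTopology _).top_mem W,
    fun V g' _ => ⟨fun k => k.elim, fun i => ?_⟩⟩⟩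
  simp only [res_secAt, ← onSec_freeMk, onSec_id] at hr
  rw [freeMk_injective (hr.trans freeMk_zero.symm), map_zero]
  exact Finset.sum_empty.symm

variable {M N : SheafOfModules.{u} (specRingSheaf A)}

/-- Over `Spec A`, a global section which is locally in the image is in the image. -/
lemma Localizing.exists_onSec_eq (hM : Localizing M) (hN : Localizing N) (φ : M ⟶ N)
    (y : N.Sec (⊤ : Opens (PrimeSpectrum A)))
    (h : ∀ x : PrimeSpectrum A, ∃ (V : Opens (PrimeSpectrum A)) (g : V ⟶ ⊤), x ∈ V ∧
      ∃ m, onSec φ V m = N.res g y) :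
    ∃ m, onSec φ (⊤ : Opens (PrimeSpectrum A)) m = y := by
  -- The elements `a` for which `a • y` is in the image form an ideal. If a maximal ideal contained
  -- it, clearing denominators in a preimage of `y` near that point would produce a power of some
  -- `a` outside the maximal ideal but inside `I`.
  let I : Ideal A :=
    { carrier := {a | ∃ m, onSec φ (⊤ : Opens (PrimeSpectrum A)) m = specSec A ⊤ a • y}
      zero_mem' := ⟨0, by rw [map_zero, map_zero, zero_smul]⟩
      add_mem' := by
        rintro a b ⟨m, hm⟩ ⟨m', hm'⟩
        exact ⟨m + m', by rw [map_add, hm, hm', map_add, add_smul]⟩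
      smul_mem' := by
        rintro c a ⟨m, hm⟩
        exact ⟨specSec A ⊤ c • m, by rw [map_smul, hm, smul_eq_mul, map_mul, mul_smul]⟩ }
  have hI : I = ⊤ := by
    by_contra hI
    obtain ⟨p, hp, hIp⟩ := Ideal.exists_le_maximal I hI
    let x : PrimeSpectrum A := ⟨p, hp.isPrime⟩
    obtain ⟨V, g, hxV, m, hm⟩ := h x
    obtain ⟨a, hxa, haV⟩ := exists_mem_basicOpen hxV
    obtain ⟨n, t, ht⟩ := hM.lift a (M.res (homOfLE haV) m)
    obtain ⟨k, hk⟩ := hN.zero a (onSec φ ⊤ t - specSec A ⊤ (a ^ n) • y) (by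
      rw [map_sub, ← onSec_res, ht, map_smul, onSec_res, hm, res_res, res_smul, resR_specSec]
      exact sub_self _)
    refine hxa (hp.isPrime.mem_of_pow_mem (k + n) (hIp ⟨specSec A ⊤ (a ^ k) • t, ?_⟩))
    rw [smul_sub, sub_eq_zero] at hk
    rw [map_smul, hk, ← mul_smul, ← map_mul, pow_add]
  obtain ⟨m, hm⟩ : (1 : A) ∈ I := hI ▸ Submodule.mem_top
  exact ⟨m, by rw [hm, map_one, one_smul]⟩

/-- Left exactness of localization on elements: a lift to `M` of a multiple of the section has image
in `N` killed by a further power of `a`, and multiplying by it moves the lift into `K`. -/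
lemma Localizing.of_leftExact (hM : Localizing M) (hN : Localizing N) (φ : M ⟶ N)
    {K : SheafOfModules.{u} (specRingSheaf A)} (i : K ⟶ M)
    (hi : ∀ W, Function.Injective (onSec i W)) (h0 : ∀ W t, onSec φ W (onSec i W t) = 0)
    (hex : ∀ t : M.Sec (⊤ : Opens (PrimeSpectrum A)), onSec φ ⊤ t = 0 → ∃ t', onSec i ⊤ t' = t) :
    Localizing K := by
  refine ⟨fun a s => ?_, fun a t ht => ?_⟩
  · obtain ⟨n, t, ht⟩ := hM.lift a (onSec i _ s)
    obtain ⟨k, hk⟩ := hN.zero a (onSec φ ⊤ t) (by rw [← onSec_res, ht, map_smul, h0, smul_zero])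
    obtain ⟨t', ht'⟩ := hex (specSec A ⊤ (a ^ k) • t) (by rw [map_smul, hk])
    refine ⟨k + n, t', hi _ ?_⟩
    rw [onSec_res, ht', res_smul, resR_specSec, ht, map_smul, ← mul_smul, ← map_mul, pow_add]
  · obtain ⟨n, hn⟩ := hM.zero a (onSec i ⊤ t) (by rw [← onSec_res, ht, map_zero])
    exact ⟨n, hi _ (by rw [map_smul, hn, map_zero])⟩

lemma localizing_kernel (hM : Localizing M) (hN : Localizing N) (φ : M ⟶ N) :
    Localizing (kernel φ) :=
  hM.of_leftExact hN φ (kernel.ι φ) (onSec_kernel_ι_injective φ)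
    (fun _ => onSec_onSec_kernel_ι φ) (exists_onSec_kernel_ι_eq φ)

lemma isUnit_specSec_basicOpen (a : A) : IsUnit (specSec A (basicOpen a) a) :=
  @IsLocalization.Away.algebraMap_isUnit A _ _ _ (StructureSheaf.openAlgebra A _) a
    (StructureSheaf.IsLocalization.to_basicOpen A a)

/-- Over `Spec A`, local generators can be replaced by global ones. -/
lemma Localizing.exists_spans (hM : Localizing M) (h : LocallyFG M) :
    ∃ (ι : Type u) (_ : Fintype ι) (_ : Nonempty ι) (s : ι → M.Sec (⊤ : Opens (PrimeSpectrum A))),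
      Spans M s := by
  classical
  have key (x : PrimeSpectrum A) : ∃ a : A, x ∈ basicOpen a ∧ ∃ (ι : Type u) (_ : Fintype ι)
      (s : ι → M.Sec (basicOpen a)), Spans M s ∧
      ∃ t : ι → M.Sec (⊤ : Opens (PrimeSpectrum A)), ∀ i, ∃ b : RSec (specRingSheaf A) (basicOpen a),
        s i = b • M.res (homOfLE le_top) (t i) := by
    obtain ⟨Z, hxZ, ι, _, s, hs⟩ := h x
    obtain ⟨a, hxa, haZ⟩ := exists_mem_basicOpen hxZ
    choose n t ht using fun i => hM.lift a (M.res (homOfLE haZ) (s i))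
    refine ⟨a, hxa, ι, inferInstance, _, hs.restrict (homOfLE haZ), t, fun i => ?_⟩
    obtain ⟨b, hb⟩ := ((isUnit_specSec_basicOpen a).pow (n i)).exists_left_inv
    exact ⟨b, by rw [ht, ← mul_smul, map_pow, hb, one_smul]⟩
  choose a hxa ι hι s hs t b hb using key
  obtain ⟨T, hT⟩ := isCompact_univ.elim_nhds_subcover (fun x => (basicOpen (a x) : Set _))
    fun x _ => (basicOpen (a x)).isOpen.mem_nhds (hxa x)
  -- Finitely many basic opens suffice by quasi-compactness. The additional index carries the zero
  -- section and keeps the family nonempty.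
  refine ⟨Option (Σ x : T, ι x), inferInstance, inferInstance,
    fun k => k.elim 0 fun p => t p.1 p.2, Spans.of_locally fun x _ => ?_⟩
  obtain ⟨y, hy, hxy⟩ := Set.mem_iUnion₂.mp (hT.2 (Set.mem_univ x))
  refine ⟨basicOpen (a y), homOfLE le_top, hxy, ι y, inferInstance, s y, hs y, fun i =>
    ⟨Pi.single (some ⟨⟨y, hy⟩, i⟩) (b y i), ?_⟩⟩
  rw [Finset.sum_eq_single (some ⟨⟨y, hy⟩, i⟩)]
  · rw [Pi.single_eq_same]
    exact hb y i
  · intro j _ hj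
    rw [Pi.single_eq_of_ne hj, zero_smul]
  · exact fun h => (h (Finset.mem_univ _)).elim

end AlgebraicGeometry

/-! ### Passing between global presentations and generating relations -/

namespace SheafOfModules

variable {X : Type u} [TopologicalSpace X] {R : Sheaf (Opens.grothendieckTopology X) RingCat.{u}}
  {M : SheafOfModules.{u} R} {ι κ : Type u} [Fintype ι] [Fintype κ]

lemma exists_epi_of_spans {s : ι → M.Sec (⊤ : Opens X)} (hs : Spans M s) :
    ∃ g : free ι ⟶ M, Epi g ∧ ∀ i, secAt (M.freeHomEquiv g i) (⊤ : Opens X) = s i := by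
  have h (i : ι) : secAt (M.freeHomEquiv (M.freeHomEquiv.symm fun i =>
      mkSection (isTerminalTop : IsTerminal (⊤ : Opens X)) M (s i)) i) ⊤ = s i := by
    rw [Equiv.apply_symm_apply, secAt_mkSection]
    exact res_id _ _ _
  refine ⟨_, (epi_iff_spans _ isTerminalTop).mpr ?_, h⟩
  simpa only [h] using hs

lemma exists_genRelations_of_exact {f : free ι ⟶ M} {h : (free κ : SheafOfModules.{u} R) ⟶ free ι}
    {w : h ≫ f = 0} (hex : (ShortComplex.mk h f w).Exact) :
    ∃ ρ : κ → ι → RSec R (⊤ : Opens X), GenRelations M (fun i => secAt (M.freeHomEquiv f i) ⊤) ρ := by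
  choose ρ hρ using fun k => freeMk_surjective (secAt ((free ι).freeHomEquiv h k) (⊤ : Opens X))
  have key {W : Opens X} (c : κ → RSec R W) :
      onSec h W (freeMk c) = freeMk fun i => ∑ k, c k * resR R (homOfLE le_top) (ρ k i) := by
    rw [onSec_freeMk, ← freeMk_sum]
    refine Finset.sum_congr rfl fun i _ => ?_
    rw [← res_secAt _ (homOfLE le_top : W ⟶ ⊤), ← hρ, res_freeMk]
  refine ⟨ρ, fun k => ?_, fun W g r hr => ?_⟩
  · rw [← onSec_freeMk, hρ]
    change onSec (ιFree k ≫ h ≫ f) ⊤ (ofR R ⊤ 1) = 0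
    rw [w, comp_zero, onSec_zero]
  · simp only [res_secAt, ← onSec_freeMk] at hr
    obtain ⟨T, hT, H⟩ := exists_locally_of_exact hex W (freeMk r) hr
    refine ⟨T, hT, fun V g' hg' => ?_⟩
    obtain ⟨m, hm⟩ := H V g' hg'
    obtain ⟨c, rfl⟩ := freeMk_surjective m
    refine ⟨c, congrFun (freeMk_injective (((res_freeMk g' r).symm.trans hm.symm).trans (key c)))⟩

/-- Finite generation of the relations does not depend on the chosen generators, by
`exists_genRelations_of_locallyFP`. -/
lemma locallyFG_kernel_of_locallyFP (h : LocallyFP M) (g : free ι ⟶ M) [Epi g] :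
    LocallyFG (kernel g) := by
  rw [← isFiniteType_iff_locallyFG, isFiniteType_kernel_iff_locally]
  intro x
  obtain ⟨V, i, hxV, κ, _, ρ, hρ⟩ := exists_genRelations_of_locallyFP h
    ((epi_iff_spans g (isTerminalTop : IsTerminal (⊤ : Opens X))).mp inferInstance) (x := x) trivial
  simp only [res_secAt] at hρ
  exact ⟨V, hxV, κ, inferInstance, ρ, hρ⟩

lemma locallyFP_unit : LocallyFP (unit R) := by
  refine fun x => ⟨⊤, trivial, PUnit, inferInstance, fun _ => ofR R ⊤ 1, PEmpty, inferInstance,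
    PEmpty.elim, fun W f t => ⟨⊤, (Opens.grothendieckTopology _).top_mem W, fun V g _ =>
    ⟨fun _ => resR R g ((ofR R W).symm t), ?_⟩⟩, fun k => k.elim, fun W f r hr =>
    ⟨⊤, (Opens.grothendieckTopology _).top_mem W, fun V g _ => ⟨fun k => k.elim, fun i => ?_⟩⟩⟩
  · rw [Finset.univ_unique, Finset.sum_singleton, res_ofR, map_one, ← map_smul, smul_eq_mul,
      mul_one]
    rfl
  · rw [Finset.univ_unique, Finset.sum_singleton, res_ofR, map_one, ← map_smul, smul_eq_mul,
      mul_one, LinearEquiv.map_eq_zero_iff] at hr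
    rw [Subsingleton.elim i default, hr, map_zero, Finset.univ_eq_empty, Finset.sum_empty]

/-- The diagonal case of `GenRelations.of_change`. It serves to clear denominators, where the two
families differ by units. -/
lemma GenRelations.of_smul {V : Opens X} {s t : ι → M.Sec V} {ρ : κ → ι → RSec R V}
    (hρ : GenRelations M t ρ) (v u : ι → RSec R V) (hv : ∀ i, v i • t i = s i)
    (hu : ∀ i, u i • s i = t i) :
    ∃ (κ' : Type u) (_ : Fintype κ') (ρ' : κ' → ι → RSec R V), GenRelations M s ρ' := by
  classical
  have key (c : ι → RSec R V) (m : ι → M.Sec V) (i : ι) :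
      ∑ j, (Pi.single i (c i) : ι → RSec R V) j • m j = c i • m i := by
    rw [Finset.sum_eq_single i]
    · rw [Pi.single_eq_same]
    · intro j _ hj
      rw [Pi.single_eq_of_ne hj, zero_smul]
    · exact fun h => (h (Finset.mem_univ _)).elim
  exact ⟨_, inferInstance, _, hρ.of_change (fun i => Pi.single i (v i))
    (fun i => Pi.single i (u i)) (fun i => (key v t i).trans (hv i))
    (fun i => (key u s i).trans (hu i))⟩

end SheafOfModules

namespace AlgebraicGeometry.LocallyRingedSpace

open SheafOfModules

variable {X : LocallyRingedSpace.{u}}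

lemma locallyFP_of_isACoherent {F : X.Modules} (hF : X.isACoherent F) : LocallyFP F := by
  obtain ⟨I, J, _, _, _, _, f, g, w, h, _⟩ := hF
  have := Fintype.ofFinite I
  have := Fintype.ofFinite J
  obtain ⟨ρ, hρ⟩ := exists_genRelations_of_exact h
  exact fun x => ⟨⊤, trivial, J, inferInstance, _, I, inferInstance, ρ,
    (epi_iff_spans g isTerminalTop).mp inferInstance, hρ⟩

lemma isACoherent_of_epi_kernel {I J : Type u} [Finite I] [Finite J] [Nonempty I] [Nonempty J]
    {F : X.Modules} (g : (SheafOfModules.free J : X.Modules) ⟶ F) [Epi g]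
    (h : (SheafOfModules.free I : X.Modules) ⟶ kernel g) [Epi h] : X.isACoherent F := by
  refine ⟨I, J, inferInstance, inferInstance, inferInstance, inferInstance, h ≫ kernel.ι g, g,
    by rw [Category.assoc, kernel.condition, comp_zero], ?_, inferInstance⟩
  rw [ShortComplex.exact_iff_epi_kernel_lift]
  have : kernel.lift g (h ≫ kernel.ι g)
      (by rw [Category.assoc, kernel.condition, comp_zero]) = h := by
    rw [← cancel_mono (kernel.ι g), kernel.lift_ι]
  change Epi (kernel.lift g (h ≫ kernel.ι g) _)
  rw [this]
  infer_instance

end AlgebraicGeometry.LocallyRingedSpace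

/-! ### Coherent and finitely presented modules on the spectrum -/

namespace AlgebraicGeometry

open SheafOfModules LocallyRingedSpace

variable {A : CommRingCat.{u}}

/-- All three terms are finitely presented, hence localizing, so `Localizing.exists_onSec_eq` turns
the local preimages given by exactness into global ones. -/
lemma sectionsExactOnPresentations_spec :
    (Spec.locallyRingedSpaceObj A).SectionsExactOnPresentations := by
  intro S I J _ _ _ _ e₁ e₂ hS _
  have h₁ : Localizing S.X₁ := .of_locallyFP
    (locallyFP_of_isACoherent (isACoherent_of_iso e₁.symm (isACoherent_free I)))
  have h₂ : Localizing S.X₂ := .of_locallyFP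
    (locallyFP_of_isACoherent (isACoherent_of_iso e₂.symm (isACoherent_free J)))
  have h₃ : Localizing S.X₃ := by
    refine .of_locallyFP (locallyFP_of_isACoherent ⟨I, J, inferInstance, inferInstance,
      inferInstance, inferInstance, e₁.inv ≫ S.f ≫ e₂.hom, e₂.inv ≫ S.g, by simp, ?_,
      inferInstance⟩)
    exact ShortComplex.exact_of_iso (ShortComplex.isoMk e₁ e₂ (Iso.refl _)) hS
  refine ⟨fun y => h₂.exists_onSec_eq h₃ S.g y fun x => exists_mem_range_of_epi S.g y trivial,
    fun y hy => h₁.exists_onSec_eq h₂ S.f y fun x => exists_mem_range_of_exact hS y hy trivial⟩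

/-- Over `Spec A`, a module which is locally finitely presented is globally so. -/
lemma exists_presentation_of_locallyFP {F : SheafOfModules.{u} (specRingSheaf A)}
    (h : LocallyFP F) : ∃ (I J : Type u) (_ : Finite I) (_ : Finite J) (_ : Nonempty I)
      (_ : Nonempty J) (g : free J ⟶ F) (k : free I ⟶ kernel g), Epi g ∧ Epi k := by
  have hF : Localizing F := .of_locallyFP h
  obtain ⟨J, _, _, s, hs⟩ := hF.exists_spans fun x => by
    obtain ⟨Z, hx, ι, _, s, _, _, _, hs, _⟩ := h x
    exact ⟨Z, hx, ι, _, s, hs⟩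
  obtain ⟨g, hg, -⟩ := exists_epi_of_spans hs
  obtain ⟨I, _, _, t, ht⟩ := (localizing_kernel (localizing_free J) hF g).exists_spans
    (locallyFG_kernel_of_locallyFP h g)
  obtain ⟨k, hk, -⟩ := exists_epi_of_spans ht
  exact ⟨I, J, inferInstance, inferInstance, inferInstance, inferInstance, g, k, hg, hk⟩

lemma isFinitelyPresented_spec_eq :
    (Spec.locallyRingedSpaceObj A).isFinitelyPresented =
      (Spec.locallyRingedSpaceObj A).isACoherent := by
  funext F
  refine propext ⟨fun h => ?_, fun h => (isFinitelyPresented_iff F).mpr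
    (locallyFP_of_isACoherent h)⟩
  obtain ⟨I, J, _, _, _, _, g, k, hg, hk⟩ :=
    exists_presentation_of_locallyFP ((isFinitelyPresented_iff F).mp h)
  exact @isACoherent_of_epi_kernel (Spec.locallyRingedSpaceObj A) I J _ _ _ _ F g hg k hk

/-- A triangle identity of the adjunction between `Γ` and `Spec` shows that this morphism is an
isomorphism. Consequently the results on flat `X.toΓSpec` apply to the spectrum itself. -/
lemma isFlat_toΓSpec_spec : IsFlat (Spec.locallyRingedSpaceObj A).toΓSpec := by
  have : IsIso (Spec.locallyRingedSpaceObj A).toΓSpec := by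
    have h := ΓSpec.right_triangle A
    have h₁ : IsIso (Spec.toLocallyRingedSpace.map (SpecΓIdentity.inv.app A).op) := inferInstance
    exact @IsIso.of_isIso_comp_right _ _ _ _ _ _ _ h₁
      ((congrArg (fun f => IsIso f) h).mpr (IsIso.id _))
  intro x
  have := (ConcreteCategory.bijective_of_isIso
    (Hom.stalkMap (Spec.locallyRingedSpaceObj A).toΓSpec x))
  exact RingHom.Flat.of_bijective this

/-- The relations between finitely many global functions are generated by finitely many global
relations, if `X ⟶ Spec Γ(X, 𝒪_X)` is flat and `Γ(X, 𝒪_X)` is noetherian. -/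
lemma LocallyRingedSpace.exists_genRelations_unit {X : LocallyRingedSpace.{u}}
    [IsNoetherianRing (Γ.obj (op X))] (hflat : IsFlat X.toΓSpec) {ι : Type u} [Fintype ι]
    (t : ι → (unit X.ringCatSheaf).Sec (⊤ : Opens X.carrier)) :
    ∃ (κ : Type u) (_ : Fintype κ) (ρ : κ → ι → RSec X.ringCatSheaf (⊤ : Opens X.carrier)),
      GenRelations (unit X.ringCatSheaf) t ρ := by
  -- Relations between functions are relations between the rows of a matrix with a single column.
  let a : ι → PUnit.{u + 1} → Γ.obj (op X) := fun i _ => t i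
  obtain ⟨K, _, _, ρ, hρ, hρ'⟩ := IsNoetherianRing.exists_generating_relations a
  refine ⟨K, inferInstance, ρ, (genRelations_iff_forall_mem _ _ _).mpr
    ⟨fun k => hρ k ⟨⟩, fun W g y hy x hx => ?_⟩⟩
  obtain ⟨V, g', hxV, d, hd⟩ := exists_germ_relations (a := a) hflat hρ' y (fun _ => hy) hx
  exact ⟨V, g', ⟨d, hd⟩, hxV⟩

/-- The structure sheaf of the spectrum of a noetherian ring is coherent. -/
lemma relationsFG_unit_spec [IsNoetherianRing A] : RelationsFG (unit (specRingSheaf A)) := by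
  classical
  intro U ι _ s x hx
  have hloc : Localizing (unit (specRingSheaf A)) := .of_locallyFP locallyFP_unit
  have : IsNoetherianRing (LocallyRingedSpace.Γ.obj (op (Spec.locallyRingedSpaceObj A))) :=
    isNoetherianRing_of_surjective A _ (Scheme.ΓSpecIso A).inv.hom
      (ConcreteCategory.bijective_of_isIso (Scheme.ΓSpecIso A).inv).2
  -- On a basic open each section is a unit times the restriction of a global function, so the
  -- relations between those global functions can be transported.
  obtain ⟨a, hxa, haU⟩ := exists_mem_basicOpen hx
  choose n t ht using fun i => hloc.lift a ((unit (specRingSheaf A)).res (homOfLE haU) (s i))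
  choose v hv using fun i => ((isUnit_specSec_basicOpen a).pow (n i)).exists_left_inv
  have hv' (i : ι) : v i • (unit (specRingSheaf A)).res (homOfLE le_top) (t i) =
      (unit (specRingSheaf A)).res (homOfLE haU) (s i) := by
    rw [ht, ← mul_smul, map_pow, hv, one_smul]
  obtain ⟨κ, _, ρ, hρ⟩ := exists_genRelations_unit isFlat_toΓSpec_spec t
  obtain ⟨κ', _, ρ', hρ'⟩ := (GenRelations.restrict (R := specRingSheaf A) hρ
    (homOfLE le_top)).of_smul (s := fun i => (unit (specRingSheaf A)).res (homOfLE haU) (s i))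
    v (fun i => specSec A _ (a ^ n i)) hv' (fun i => (ht i).symm)
  exact ⟨_, homOfLE haU, hxa, κ', inferInstance, ρ', hρ'⟩

lemma isCoherent_spec_eq [IsNoetherianRing A] :
    (Spec.locallyRingedSpaceObj A).isCoherent = (Spec.locallyRingedSpaceObj A).isACoherent := by
  funext F
  refine propext ⟨fun h => ?_, fun h => ?_⟩
  · rw [← isFinitelyPresented_spec_eq]
    exact isFinitelyPresented_of_isCoherent F h
  · obtain ⟨I, J, _, _, _, _, f, g, w, hex, _⟩ := h
    have := Fintype.ofFinite I
    have := Fintype.ofFinite J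
    rw [isCoherent_iff]
    exact ⟨(locallyFG_free J).of_epi g, RelationsFG.of_epi hex (locallyFG_free I)
      (relationsFG_free relationsFG_unit_spec J)⟩

end AlgebraicGeometry

/-! ### Morphisms out of globally presented modules -/

namespace SheafOfModules

section

variable {X : Type u} [TopologicalSpace X] {R : Sheaf (Opens.grothendieckTopology X) RingCat.{u}}
  {M N F : SheafOfModules.{u} R} {I J : Type u}

lemma free_hom_ext {k l : free I ⟶ M} (h : ∀ i, secAt (M.freeHomEquiv k i) (⊤ : Opens X) =
    secAt (M.freeHomEquiv l i) ⊤) : k = l := by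
  refine M.freeHomEquiv.injective (funext fun i => sections_ext' fun W => ?_)
  rw [← res_secAt _ (homOfLE le_top : W ⟶ ⊤), h, res_secAt]

lemma exists_free_hom (s : I → M.Sec (⊤ : Opens X)) :
    ∃ k : free I ⟶ M, ∀ i, secAt (M.freeHomEquiv k i) (⊤ : Opens X) = s i := by
  refine ⟨M.freeHomEquiv.symm fun i =>
      mkSection (isTerminalTop : IsTerminal (⊤ : Opens X)) M (s i), fun i => ?_⟩
  rw [Equiv.apply_symm_apply, secAt_mkSection]
  exact res_id _ _ _

lemma secAt_freeHomEquiv_comp (k : free I ⟶ M) (η : M ⟶ N) (i : I) (W : Opens X) :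
    secAt (N.freeHomEquiv (k ≫ η) i) W = onSec η W (secAt (M.freeHomEquiv k i) W) := rfl

/-- A morphism out of `free I` is an `I`-tuple of global sections, and `η` is bijective on these. -/
lemma bijective_free_comp {η : M ⟶ N} (hη : Function.Bijective (onSec η (⊤ : Opens X))) :
    Function.Bijective (fun k : free I ⟶ M => k ≫ η) := by
  refine ⟨fun k l h => free_hom_ext fun i => hη.1 ?_, fun l => ?_⟩
  · rw [← secAt_freeHomEquiv_comp, ← secAt_freeHomEquiv_comp]
    exact congr(secAt (N.freeHomEquiv $h i) ⊤)
  · choose s hs using fun i => hη.2 (secAt (N.freeHomEquiv l i) ⊤)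
    obtain ⟨k, hk⟩ := exists_free_hom s
    refine ⟨k, free_hom_ext fun i => ?_⟩
    rw [secAt_freeHomEquiv_comp, hk, hs]

/-- A morphism which is bijective on global sections induces bijections on morphisms from a
globally presented module. -/
lemma bijective_comp_of_exact {η : M ⟶ N} (hη : Function.Bijective (onSec η (⊤ : Opens X)))
    {f : (free I : SheafOfModules.{u} R) ⟶ free J} {g : free J ⟶ F} {w : f ≫ g = 0}
    (h : (ShortComplex.mk f g w).Exact) [Epi g] :
    Function.Bijective (fun k : F ⟶ M => k ≫ η) := by
  refine ⟨fun k l hkl => ?_, fun l => ?_⟩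
  · rw [← cancel_epi g]
    refine (bijective_free_comp hη).1 ?_
    dsimp only at hkl ⊢
    rw [Category.assoc, hkl, Category.assoc]
  · obtain ⟨k, hk⟩ := (bijective_free_comp hη).2 (g ≫ l)
    dsimp only at hk
    -- Composition with `η` is injective on maps out of `free I`, and it sends `f ≫ k` to `f ≫ g ≫ l
    -- = 0`; hence `k` descends to `F`.
    have hfk : f ≫ k = 0 := (bijective_free_comp hη).1 (by
      dsimp only
      rw [Category.assoc, hk, reassoc_of% w, zero_comp, zero_comp])
    have : Epi (ShortComplex.mk f g w).g := ‹Epi g›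
    refine ⟨h.desc k hfk, ?_⟩
    rw [← cancel_epi g]
    exact ((Category.assoc _ _ _).symm.trans (congrArg (· ≫ η) (h.g_desc k hfk))).trans hk

lemma bijective_onSec_of_isIso (η : M ⟶ N) [IsIso η] (W : Opens X) :
    Function.Bijective (onSec η W) :=
  Function.bijective_iff_has_inverse.mpr ⟨onSec (inv η) W,
    fun t => congr(onSec $(IsIso.hom_inv_id η) W t), fun t => congr(onSec $(IsIso.inv_hom_id η) W t)⟩

end

section

variable {C : Type*} [Category* C] {D : Type*} [Category* D] {J : GrothendieckTopology C}
  {K : GrothendieckTopology D} {F : C ⥤ D} {S : Sheaf J RingCat.{u}} {R : Sheaf K RingCat.{u}}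
  [Functor.IsContinuous F J K] (φ : S ⟶ (F.sheafPushforwardContinuous RingCat.{u} J K).obj R)
  [(pushforward.{u} φ).IsRightAdjoint] [F.Final]

lemma isIso_pullbackObjUnitToUnit : IsIso (pullbackObjUnitToUnit φ) := inferInstance

end

end SheafOfModules

/-! ### The pullback functor and the equivalence -/

namespace AlgebraicGeometry.LocallyRingedSpace

open SheafOfModules

variable {X Y : LocallyRingedSpace.{u}} (φ : X ⟶ Y)

/-- The functor `f^*` is left adjoint to `f_*`. -/
def pullbackAdjunction : pullback φ ⊣ SheafOfModules.pushforward.{u} (Hom.toRingCatSheafHom φ) :=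
  SheafOfModules.pullbackPushforwardAdjunction.{u} _

/-- The canonical map `Γ(Y, G) ⟶ Γ(X, f^* G)`. -/
def pullbackSec (G : Y.Modules) : G.Sec (⊤ : Opens Y.carrier) →+
    ((pullback φ).obj G).Sec (⊤ : Opens X.carrier) :=
  (onSec ((pullbackAdjunction φ).unit.app G) (⊤ : Opens Y.carrier)).toAddMonoidHom

lemma pullbackSec_onSec {G G' : Y.Modules} (k : G ⟶ G') (t : G.Sec (⊤ : Opens Y.carrier)) :
    pullbackSec φ G' (onSec k ⊤ t) = onSec ((pullback φ).map k) (⊤ : Opens X.carrier)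
      (pullbackSec φ G t) :=
  congr(onSec $((pullbackAdjunction φ).unit.naturality k) (⊤ : Opens Y.carrier) t)

/-- Every open subset of `X` is contained in the preimage of `⊤`. Finality is what makes the
pullback of the structure sheaf the structure sheaf, and likewise for free modules. -/
instance : (Opens.map φ.base).Final :=
  Functor.final_of_exists_of_isFiltered _ (fun _ => ⟨⊤, ⟨homOfLE le_top⟩⟩)
    fun {_ c} _ _ => ⟨c, 𝟙 c, Subsingleton.elim _ _⟩

instance : (SheafOfModules.pushforward.{u} (Hom.toRingCatSheafHom φ)).Additive where

instance : (pullback φ).IsLeftAdjoint := (pullbackAdjunction φ).isLeftAdjoint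

instance : (pullback φ).Additive :=
  (pullbackAdjunction φ).left_adjoint_additive

/-- The pullback of a free module is free. -/
def pullbackFreeIso (I : Type u) :
    (pullback φ).obj (SheafOfModules.free I) ≅ SheafOfModules.free I :=
  SheafOfModules.pullbackObjFreeIso (Hom.toRingCatSheafHom φ) I

lemma exact_map_pullback {S : ShortComplex Y.Modules} (hS : S.Exact) [Epi S.g] :
    (S.map (pullback φ)).Exact ∧ Epi (S.map (pullback φ)).g :=
  ⟨hS.map_of_epi_of_preservesCokernel (pullback φ) inferInstance inferInstance,
    inferInstanceAs (Epi ((pullback φ).map S.g))⟩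

variable {φ}

/-- Under the adjunction, applying the pullback to `k` becomes composing `k` with the unit at `G`.
On global sections this unit is `pullbackSec φ G`, so `bijective_comp_of_exact` applies. -/
lemma bijective_map_of_exact {F G : Y.Modules} (hG : Function.Bijective (pullbackSec φ G))
    (hF : Y.isACoherent F) : Function.Bijective (fun k : F ⟶ G => (pullback φ).map k) := by
  obtain ⟨I, J, _, _, _, _, f, g, w, h, _⟩ := hF
  have key : ((pullbackAdjunction φ).homEquiv F _) ∘ (fun k : F ⟶ G => (pullback φ).map k) =
      fun k : F ⟶ G => k ≫ (pullbackAdjunction φ).unit.app G := by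
    funext k
    exact ((pullbackAdjunction φ).homEquiv_unit ..).trans
      ((pullbackAdjunction φ).unit_naturality k)
  rw [← ((pullbackAdjunction φ).homEquiv F _).bijective.of_comp_iff', key]
  exact bijective_comp_of_exact hG h

/-- Followed by the isomorphism from the pullback of `𝒪_Y` to `𝒪_X`, the map is that of `φ` on
global functions. -/
lemma bijective_pullbackSec_unit (hφ : Function.Bijective (φ.c.app (op ⊤)).hom) :
    Function.Bijective (pullbackSec φ (SheafOfModules.unit Y.ringCatSheaf)) := by
  have hp : (pullbackAdjunction φ).unit.app _ ≫ (SheafOfModules.pushforward _).map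
      (SheafOfModules.pullbackObjUnitToUnit (Hom.toRingCatSheafHom φ)) =
      SheafOfModules.unitToPushforwardObjUnit (Hom.toRingCatSheafHom φ) :=
    ((pullbackAdjunction φ).homEquiv_unit ..).symm.trans (Equiv.apply_symm_apply _ _)
  have : IsIso (SheafOfModules.pullbackObjUnitToUnit (Hom.toRingCatSheafHom φ)) :=
    isIso_pullbackObjUnitToUnit _
  have hp' : Function.Bijective
      (onSec (SheafOfModules.pullbackObjUnitToUnit (Hom.toRingCatSheafHom φ))
        (⊤ : Opens X.carrier)) := bijective_onSec_of_isIso _ ⊤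
  refine (Function.Bijective.of_comp_iff' hp' (pullbackSec φ _)).mp ?_
  have key : onSec (SheafOfModules.pullbackObjUnitToUnit (Hom.toRingCatSheafHom φ))
      (⊤ : Opens X.carrier) ∘ pullbackSec φ (SheafOfModules.unit Y.ringCatSheaf) =
      (φ.c.app (op ⊤)).hom := funext fun t => congr(onSec $hp (⊤ : Opens Y.carrier) t)
  exact key ▸ hφ

/-- The pullback is additive, so the decomposition of the identity of `free I` through its
coordinates survives and reduces the claim to rank one. -/
lemma bijective_pullbackSec_free (hφ : Function.Bijective (φ.c.app (op ⊤)).hom) (I : Type u)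
    [Finite I] : Function.Bijective (pullbackSec φ (SheafOfModules.free I)) := by
  have := Fintype.ofFinite I
  have h := bijective_pullbackSec_unit hφ
  constructor
  · refine (injective_iff_map_eq_zero _).mpr fun t ht => ?_
    obtain ⟨c, rfl⟩ := freeMk_surjective t
    refine (congrArg freeMk (funext fun i => ?_)).trans freeMk_zero
    refine h.1 ?_
    have h' := pullbackSec_onSec φ (freeCoord (R := Y.ringCatSheaf) i) (freeMk c)
    rw [ht, map_zero] at h'
    exact (congrArg (pullbackSec φ _) (onSec_freeCoord_freeMk c i)).symm.trans
      (h'.trans (map_zero _).symm)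
  · intro u
    choose v hv using fun i : I => h.2 (onSec ((pullback φ).map (freeCoord i)) (⊤ : Opens X.carrier) u)
    refine ⟨∑ i, onSec (ιFree i) ⊤ (v i), ?_⟩
    have h1 : ∑ i : I, (pullback φ).map (freeCoord i) ≫ (pullback φ).map (ιFree i) =
        𝟙 ((pullback φ).obj (SheafOfModules.free I)) := by
      refine Eq.trans ?_ ((pullback φ).map_id _)
      simp only [← Functor.map_comp, ← Functor.map_sum, sum_freeCoord_ιFree]
    refine ((map_sum _ _ _).trans (Finset.sum_congr rfl fun i _ => ?_)).trans
      ((onSec_sum _ _).symm.trans congr(onSec $h1 (⊤ : Opens X.carrier) u))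
    exact (pullbackSec_onSec φ _ _).trans (congrArg _ (hv i))

/-- Five lemma: a presentation of `F` and its pullback stay exact on global sections, and the
comparison maps at the two free terms are bijective. -/
lemma bijective_pullbackSec_of_isACoherent (hφ : Function.Bijective (φ.c.app (op ⊤)).hom)
    (hX : X.SectionsExactOnPresentations) (hY : Y.SectionsExactOnPresentations)
    {F : Y.Modules} (hF : Y.isACoherent F) : Function.Bijective (pullbackSec φ F) := by
  obtain ⟨I, J, _, _, _, _, f, g, w, h, _⟩ := hF
  obtain ⟨hex, hepi⟩ := exact_map_pullback φ h
  obtain ⟨h₁, h₂⟩ := hX _ I J (pullbackFreeIso φ I) (pullbackFreeIso φ J) hex hepi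
  obtain ⟨h₃, -⟩ := hY _ I J (Iso.refl _) (Iso.refl _) h ‹_›
  have hI := bijective_pullbackSec_free hφ I
  have hJ := bijective_pullbackSec_free hφ J
  constructor
  · refine (injective_iff_map_eq_zero _).mpr fun t ht => ?_
    obtain ⟨s, rfl⟩ := h₃ t
    obtain ⟨u, hu⟩ := h₂ _ ((pullbackSec_onSec φ g s).symm.trans ht)
    obtain ⟨v, rfl⟩ := hI.2 u
    obtain rfl : onSec f ⊤ v = s := hJ.1 ((pullbackSec_onSec φ f v).trans hu)
    exact congr(onSec $w ⊤ v)
  · intro u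
    obtain ⟨u', rfl⟩ := h₁ u
    obtain ⟨s, rfl⟩ := hJ.2 u'
    exact ⟨onSec g ⊤ s, pullbackSec_onSec φ g s⟩

lemma isACoherent_pullback {F : Y.Modules} (hF : Y.isACoherent F) :
    X.isACoherent ((pullback φ).obj F) := by
  obtain ⟨I, J, _, _, _, _, f, g, w, h, _⟩ := hF
  obtain ⟨hex, _⟩ := exact_map_pullback φ h
  have : Epi ((pullback φ).map g) := inferInstance
  refine ⟨I, J, inferInstance, inferInstance, inferInstance, inferInstance,
    (pullbackFreeIso φ I).inv ≫ (pullback φ).map f ≫ (pullbackFreeIso φ J).hom,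
    (pullbackFreeIso φ J).inv ≫ (pullback φ).map g, ?_, ?_, inferInstance⟩
  · rw [Category.assoc, Category.assoc, Iso.hom_inv_id_assoc, ← Functor.map_comp, w,
      Functor.map_zero, comp_zero]
  · refine ShortComplex.exact_of_iso (S₁ := (ShortComplex.mk f g w).map (pullback φ))
      (ShortComplex.isoMk (pullbackFreeIso φ I) (pullbackFreeIso φ J) (Iso.refl _) ?_ ?_) hex
    · exact Iso.hom_inv_id_assoc _ _
    · exact (Iso.hom_inv_id_assoc _ _).trans (Category.comp_id _).symm

/-- A morphism which is bijective on global functions induces an equivalence on globally presented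
modules if taking global sections is exact on presentations. -/
theorem pullbackInducesEquivalence_isACoherent (hφ : Function.Bijective (φ.c.app (op ⊤)).hom)
    (hX : X.SectionsExactOnPresentations) (hY : Y.SectionsExactOnPresentations) :
    PullbackInducesEquivalence φ Y.isACoherent X.isACoherent := by
  have hbij {F G : Y.Modules} (hF : Y.isACoherent F) (hG : Y.isACoherent G) :
      Function.Bijective (fun k : F ⟶ G => (pullback φ).map k) :=
    bijective_map_of_exact (bijective_pullbackSec_of_isACoherent hφ hX hY hG) hF
  refine ⟨fun G => isACoherent_pullback G.property, ?_⟩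
  refine { faithful := ⟨fun {F G} k l hkl => ?_⟩, full := ⟨fun {F G} k => ?_⟩, essSurj := ⟨?_⟩ }
  · refine ObjectProperty.hom_ext _ ((hbij F.property G.property).1 ?_)
    exact congr(($hkl).hom)
  · obtain ⟨l, hl⟩ := (hbij F.property G.property).2 k.hom
    exact ⟨ObjectProperty.homMk l, ObjectProperty.hom_ext _ hl⟩
  · rintro ⟨F, I, J, _, _, _, _, f, g, w, h, _⟩
    -- Fullness on free modules lifts the presentation matrix of `F` to `f₀` over `Y`. As the
    -- pullback preserves cokernels, it sends the cokernel of `f₀` to `F` up to isomorphism.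
    obtain ⟨f₀, hf₀⟩ := (hbij (isACoherent_free I) (isACoherent_free J)).2
      ((pullbackFreeIso φ I).hom ≫ f ≫ (pullbackFreeIso φ J).inv)
    have hG : Y.isACoherent (cokernel f₀) :=
      ⟨I, J, inferInstance, inferInstance, inferInstance, inferInstance, f₀, cokernel.π f₀,
        cokernel.condition f₀, ShortComplex.exact_cokernel f₀, inferInstance⟩
    refine ⟨⟨cokernel f₀, hG⟩, ⟨ObjectProperty.isoMk _ ?_⟩⟩
    have : Epi (ShortComplex.mk f g w).g := ‹Epi g›
    exact PreservesCokernel.iso (pullback φ) f₀ ≪≫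
      cokernel.mapIso _ f (pullbackFreeIso φ I) (pullbackFreeIso φ J) (by
        dsimp only at hf₀
        rw [hf₀]
        simp) ≪≫
      IsColimit.coconePointUniqueUpToIso (cokernelIsCokernel f) h.gIsCokernel

end AlgebraicGeometry.LocallyRingedSpace

namespace AlgebraicGeometry.LocallyRingedSpace

/-- The other triangle identity of the adjunction between `Γ` and `Spec` exhibits this map as an
isomorphism. -/
lemma bijective_toΓSpec_app_top (X : LocallyRingedSpace.{u}) :
    Function.Bijective (X.toΓSpec.c.app (op ⊤)).hom := by
  have h := ΓSpec.left_triangle X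
  have h₁ : IsIso (SpecΓIdentity.inv.app (Γ.obj (op X))) := inferInstance
  have h₂ : IsIso (X.toΓSpec.c.app (op ⊤)) := @IsIso.of_isIso_comp_left _ _ _ _ _ _ _ h₁
    ((congrArg (fun f => IsIso f) h).mpr (IsIso.id _))
  exact ConcreteCategory.bijective_of_isIso (X.toΓSpec.c.app (op ⊤))

end AlgebraicGeometry.LocallyRingedSpace

end

theorem theorem2p2 (X : LocallyRingedSpace.{u}) (hflat : LocallyRingedSpace.IsFlat X.toΓSpec) :
    (IsNoetherianRing (LocallyRingedSpace.Γ.obj (op X)) →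
      X.GlobalSectionsExactOn X.isACoherent →
      LocallyRingedSpace.PullbackInducesEquivalence X.toΓSpec
        X.specΓ.isCoherent X.isACoherent) ∧
    (X.isCoherent (SheafOfModules.unit X.ringCatSheaf) →
      X.GlobalSectionsExactOn X.isCoherent →
      LocallyRingedSpace.PullbackInducesEquivalence X.toΓSpec
        X.specΓ.isFinitelyPresented X.isACoherent) := by
  refine ⟨fun _ h => ?_, fun hX h => ?_⟩
  · rw [isCoherent_spec_eq]
    exact LocallyRingedSpace.pullbackInducesEquivalence_isACoherent X.bijective_toΓSpec_app_top
      (LocallyRingedSpace.sectionsExactOnPresentations_of_isNoetherianRing hflat h)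
      sectionsExactOnPresentations_spec
  · rw [isFinitelyPresented_spec_eq]
    exact LocallyRingedSpace.pullbackInducesEquivalence_isACoherent X.bijective_toΓSpec_app_top
      (LocallyRingedSpace.sectionsExactOnPresentations_of_isCoherent hX h)
      sectionsExactOnPresentations_spec
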